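/- **Proposition (Information constraint).** Fix a finite state space $\mathcal S$, a finite non-empty set of actions $\mathcal A(s)$ for every $s\in\mathcal S$, and let $\mathcal X=\{(s,a): s\in\mathcal S, a\in\mathcal A(s)\}$ be the set of pairs. A Markov decision process $M$ on $\mathcal X$ consists, for every $x\in\mathcal X$, of a transition law $p(x)$ on $\mathcal S$ and a reward law $r(x)$ on $\mathbb R$ with finite mean (for instance supported in $[0,1]$). A learner $\Lambda$ chooses the action at time $t$ at random, from a law that depends measurably on the past pairs and rewards $(X_1,R_1,\dots,X_{t-1},R_{t-1})$ and on the current state $S_t$. Write $X_t=(S_t,A_t)$; given the past and $X_t$, the reward $R_t\sim r(X_t)$ and the next state $S_{t+1}\sim p(X_t)$ are drawn independently. Let $\mathbb E^{M,\Lambda}_{s_0}$ be the expectation for the interaction of $\Lambda$ with $M$ started at $S_1=s_0$, and let $N_{T+1}(x)=\sum_{t=1}^{T}\mathbf 1\{X_t=x\}$. The gain of a deterministic stationary policy $\pi$ is $g^\pi(s)=\lim_{T\to\infty}\frac1T\mathbb E^{M,\pi}_{s}[\sum_{t=1}^T R_t]$, the optimal gain is $g^*(s)=\max_\pi g^\pi(s)$,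 and $\Pi^*(M)$ is the set of the policies $\pi$ with $g^\pi(s)=g^*(s)$ for every $s$. The regret is $\mathrm{Reg}(T;M,\Lambda,s_0)=T g^*(s_0)-\mathbb E^{M,\Lambda}_{s_0}[\sum_{t=1}^T R_t]$. Let $\mathcal M$ be a set of Markov decision processes on $\mathcal X$. A learner $\Lambda$ is consistent on $\mathcal M$ if $\mathrm{Reg}(T;M,\Lambda,s_0)=o(T^\eta)$ as $T\to\infty$ for every $M\in\mathcal M$, every $s_0\in\mathcal S$ and every $\eta>0$. For $M\in\mathcal M$, the alternative set $\mathrm{Alt}(M)$ is the set of all $M^\dagger\in\mathcal M$ such that $M^\dagger\gg M$, i.e. $p(x)\ll p^\dagger(x)$ and $r(x)\ll r^\dagger(x)$ for every $x\in\mathcal X$, and $\Pi^*(M^\dagger)\cap\Pi^*(M)=\emptyset$. Finally, let $\mathrm{KL}_x(M\|M^\dagger)=\mathrm{KL}(p(x)\|p^\dagger(x))+\mathrm{KL}(r(x)\|r^\dagger(x))\in[0,\infty]$. Let $M\in\mathcal M$ be communicating (every state can be reached from every state with positive probability under some choice of actions) and let $M^\dagger\in\mathrm{Alt}(M)$. Then,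 whatever the initial state $s_0\in\mathcal S$, every learner $\Lambda$ that is consistent on $\mathcal M$ satisfies $$\mathbb E^{M,\Lambda}_{s_0}\Big[\sum_{x\in\mathcal X}N_{T+1}(x)\,\mathrm{KL}_x(M\|M^\dagger)\Big]\ \ge\ \log(T)+o(\log(T))\qquad(T\to\infty),$$ where the left-hand side is in $[0,\infty]$ and $0\cdot\infty=0$. -/

import Mathlib

open MeasureTheory ProbabilityTheory Filter Topology Asymptotics
open scoped ENNReal

namespace LearnMDP

/-- State-action pairs: a state together with an action available at this state. -/
structure Pair {S : Type*} (A : S → Type*) where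
  state : S
  action : A state

section Instances

variable {S : Type*} {A : S → Type*}

noncomputable instance [Fintype S] [∀ s, Fintype (A s)] : Fintype (Pair A) :=
  Fintype.ofEquiv (Σ s, A s)
    ⟨fun x => ⟨x.1, x.2⟩, fun x => ⟨x.1, x.2⟩, fun _ => rfl, fun _ => rfl⟩

instance : MeasurableSpace (Pair A) := ⊤

instance : DiscreteMeasurableSpace (Pair A) := ⟨fun _ => trivial⟩

end Instances

/-- A Markov decision process with states `S` and actions `A s` at state `s`: transition
probabilities, and integrable reward distributions on the real line. -/
structure MDP {S : Type*} (A : S → Type*) where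
  /-- `trans x` is the law of the next state after the pair `x` is played. -/
  trans : Pair A → PMF S
  /-- `reward x` is the law of the reward received when the pair `x` is played. -/
  reward : Pair A → Measure ℝ
  reward_prob : ∀ x, IsProbabilityMeasure (reward x)
  reward_integrable : ∀ x, Integrable (fun r : ℝ => r) (reward x)

/-- A learning agent: after `n` observed steps `h = ((X₁, R₁), …, (Xₙ, Rₙ))`, standing in the
state `s = Sₙ₊₁`, it draws its action from `act n h s`. -/
structure Learner {S : Type*} (A : S → Type*) where
  act : ∀ n : ℕ, (Fin n → Pair A × ℝ) → ∀ s : S, PMF (A s)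
  measurable_act : ∀ (n : ℕ) (s : S) (a : A s), Measurable fun h => act n h s a

/-- A deterministic stationary policy, seen as a learning agent. -/
noncomputable def Learner.ofPolicy {S : Type*} {A : S → Type*} (π : ∀ s, A s) : Learner A where
  act _ _ s := PMF.pure (π s)
  measurable_act _ _ _ := measurable_const

namespace MDP

variable {S : Type*} {A : S → Type*}

/-- The reward distributions as a Markov kernel from pairs to reals. -/
noncomputable def rewardKernel (M : MDP A) : Kernel (Pair A) ℝ where
  toFun := M.reward
  measurable' := Measurable.of_discrete

instance (M : MDP A) : IsMarkovKernel M.rewardKernel := ⟨fun x => M.reward_prob x⟩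

/-- Law of the next pair, when the next state has law `q` and the action is then drawn
from `p s` at state `s`. -/
noncomputable def pairLaw (q : PMF S) (p : ∀ s, PMF (A s)) : PMF (Pair A) :=
  q.bind fun s => (p s).map fun a => ⟨s, a⟩

/-- The first `n + 1` observed steps, numbered from `0` to `n`, as a finite sequence. -/
def toHist {n : ℕ} (h : Finset.Iic n → Pair A × ℝ) : Fin (n + 1) → Pair A × ℝ :=
  fun i => h ⟨i, Finset.mem_Iic.2 (Nat.lt_succ_iff.1 i.2)⟩

lemma measurable_toHist {n : ℕ} : Measurable (toHist (A := A) (n := n)) :=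
  measurable_pi_lambda _ fun _ => measurable_pi_apply _

lemma measurable_lastPair {n : ℕ} :
    Measurable fun h : Finset.Iic n → Pair A × ℝ => (h ⟨n, Finset.mem_Iic.2 le_rfl⟩).1 :=
  measurable_fst.comp (measurable_pi_apply _)

lemma pairLaw_apply (q : PMF S) (p : ∀ s, PMF (A s)) (s : S) (a : A s) :
    pairLaw q p ⟨s, a⟩ = q s * p s a := by
  classical
  rw [pairLaw, PMF.bind_apply, tsum_eq_single s]
  · congr 1
    rw [PMF.map_apply, tsum_eq_single a]
    · simp
    · intro b hb
      rw [if_neg]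
      intro h
      exact hb (by cases h; rfl)
  · intro s' hs'
    rw [PMF.map_apply]
    have : ∀ b : A s', (if (⟨s, a⟩ : Pair A) = ⟨s', b⟩ then p s' b else 0) = 0 := by
      intro b
      rw [if_neg]
      intro h
      exact hs' (by cases h; rfl)
    simp only [this, tsum_zero, mul_zero]

variable [Fintype S] [∀ s, Fintype (A s)]

/-- Law of the pair played at step `n + 1` (steps are numbered from `0`) given the steps
`0, …, n`: the next state is drawn from the transition law of the last pair, and the action is
drawn by the learner from the whole history and the new state. -/
noncomputable def pairKernel (M : MDP A) (Λ : Learner A) (n : ℕ) :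
    Kernel (Finset.Iic n → Pair A × ℝ) (Pair A) where
  toFun h := (pairLaw (M.trans (h ⟨n, Finset.mem_Iic.2 le_rfl⟩).1)
    (Λ.act (n + 1) (toHist h))).toMeasure
  measurable' := by
    refine Measure.measurable_of_measurable_coe _ fun s hs => ?_
    simp only [PMF.toMeasure_apply_fintype]
    refine Finset.measurable_sum _ fun x _ => ?_
    by_cases hx : x ∈ s
    · simp only [Set.indicator_of_mem hx]
      obtain ⟨s', a⟩ := x
      simp only [pairLaw_apply]
      refine Measurable.mul ?_ ((Λ.measurable_act (n + 1) s' a).comp measurable_toHist)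
      exact (Measurable.of_discrete (f := fun y : Pair A => M.trans y s')).comp
        measurable_lastPair
    · simp only [Set.indicator_of_notMem hx]
      exact measurable_const

instance (M : MDP A) (Λ : Learner A) (n : ℕ) : IsMarkovKernel (M.pairKernel Λ n) :=
  ⟨fun _ => PMF.toMeasure.isProbabilityMeasure _⟩

/-- Law of the pair and reward of step `n + 1` given the steps `0, …, n`: the reward is drawn from
the reward law of the new pair, independently of everything else. -/
noncomputable def stepKernel (M : MDP A) (Λ : Learner A) (n : ℕ) :
    Kernel (Finset.Iic n → Pair A × ℝ) (Pair A × ℝ) :=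
  M.pairKernel Λ n ⊗ₖ Kernel.prodMkLeft _ M.rewardKernel

instance (M : MDP A) (Λ : Learner A) (n : ℕ) : IsMarkovKernel (M.stepKernel Λ n) := by
  unfold stepKernel
  infer_instance

/-- Law of the first pair and reward, from the initial state `s₀`. -/
noncomputable def initLaw (M : MDP A) (Λ : Learner A) (s₀ : S) : Measure (Pair A × ℝ) :=
  (pairLaw (PMF.pure s₀) (Λ.act 0 Fin.elim0)).toMeasure ⊗ₘ M.rewardKernel

instance (M : MDP A) (Λ : Learner A) (s₀ : S) : IsProbabilityMeasure (M.initLaw Λ s₀) := by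
  unfold initLaw
  infer_instance

/-- The law of the whole trajectory when the learner `Λ` interacts with `M` from `s₀`. The entry
`ω n` of a trajectory `ω` is the pair and the reward of time `n + 1`. -/
noncomputable def law (M : MDP A) (Λ : Learner A) (s₀ : S) : Measure (ℕ → Pair A × ℝ) :=
  Kernel.trajMeasure (X := fun _ => Pair A × ℝ) (M.initLaw Λ s₀) (M.stepKernel Λ)

instance (M : MDP A) (Λ : Learner A) (s₀ : S) : IsProbabilityMeasure (M.law Λ s₀) := by
  unfold law
  infer_instance

/-- Expected total reward of the first `T` steps. -/
noncomputable def expReward (M : MDP A) (Λ : Learner A) (s₀ : S) (T : ℕ) : ℝ :=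
  ∫ ω, ∑ t ∈ Finset.range T, (ω t).2 ∂(M.law Λ s₀)

/-- The gain (long-run average expected reward) of a policy. The averages converge because the
process is finite, so that the inferior limit is the limit. -/
noncomputable def gain (M : MDP A) (π : ∀ s, A s) (s : S) : ℝ :=
  liminf (fun T : ℕ => M.expReward (Learner.ofPolicy π) s T / T) atTop

/-- The optimal gain. -/
noncomputable def optGain (M : MDP A) (s : S) : ℝ := ⨆ π : ∀ s, A s, M.gain π s

/-- The set of gain-optimal policies. -/
def optPolicies (M : MDP A) : Set (∀ s, A s) := {π | ∀ s, M.gain π s = M.optGain s}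

/-- Expected regret after `T` steps. -/
noncomputable def regret (M : MDP A) (Λ : Learner A) (s₀ : S) (T : ℕ) : ℝ :=
  T * M.optGain s₀ - M.expReward Λ s₀ T

/-- Every state can be reached from every state with positive probability, under a suitable
choice of actions. -/
def IsCommunicating (M : MDP A) : Prop :=
  ∀ s s' : S, Relation.ReflTransGen (fun u v => ∃ a : A u, M.trans ⟨u, a⟩ v ≠ 0) s s'

/-- `M ≪ M'`: at every pair, the transition and reward laws of `M` are absolutely continuous
with respect to those of `M'`. -/
def IsAbsCont (M M' : MDP A) : Prop :=
  ∀ x, (M.trans x).support ⊆ (M'.trans x).support ∧ M.reward x ≪ M'.reward x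

/-- The alternative set of `M` in the class `𝓜`. -/
def alternative (𝓜 : Set (MDP A)) (M : MDP A) : Set (MDP A) :=
  {M' | M' ∈ 𝓜 ∧ M.IsAbsCont M' ∧ M'.optPolicies ∩ M.optPolicies = ∅}

/-- Information at a pair: the relative entropy of the transition laws plus that of the
reward laws. -/
noncomputable def pairKL (M M' : MDP A) (x : Pair A) : ℝ≥0∞ :=
  letI : MeasurableSpace S := ⊤
  InformationTheory.klDiv (M.trans x).toMeasure (M'.trans x).toMeasure +
    InformationTheory.klDiv (M.reward x) (M'.reward x)

open Classical in
/-- The number of visits to the pair `x` during the first `T` steps, times `1, …, T`. -/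
noncomputable def visits (T : ℕ) (x : Pair A) (ω : ℕ → Pair A × ℝ) : ℕ :=
  ((Finset.range T).filter fun t => (ω t).1 = x).card

/-- The expected information collected during the first `T` steps against `M'`. -/
noncomputable def expInfo (M M' : MDP A) (Λ : Learner A) (s₀ : S) (T : ℕ) : ℝ≥0∞ :=
  ∫⁻ ω, ∑ x : Pair A, (visits T x ω : ℝ≥0∞) * M.pairKL M' x ∂(M.law Λ s₀)

end MDP

/-- (Strong) consistency on the class `𝓜`: the regret is subpolynomial on every model of the
class and from every initial state. -/
def Learner.IsConsistent {S : Type*} {A : S → Type*} [Fintype S] [∀ s, Fintype (A s)]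
    (Λ : Learner A) (𝓜 : Set (MDP A)) : Prop :=
  ∀ M ∈ 𝓜, ∀ s₀ : S, ∀ η : ℝ, 0 < η →
    (fun T : ℕ => M.regret Λ s₀ T) =o[atTop] fun T : ℕ => (T : ℝ) ^ η

end LearnMDP

/-!
The proof is a change of measure between `M` and the alternative `M'`, applied to an event of the
first `T` steps which is likely in `M` and has probability about `1 / T` in `M'`.

*Information.* Relative entropy is used in the variational form of Donsker and Varadhan
(`DVBound`), which passes through composition with kernels without any measurability question on
densities. Since the learner draws its actions from the same laws in both models, only
transitions and rewards contribute, and the entropy of the first `T` steps is at most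
`M.expInfo M' Λ s₀ T` (`MDP.dvBound_map_past`). Testing it on the function equal to `exp l`
on an event and to `1` elsewhere gives `MDP.ofReal_le_expInfo_add`.

*Gains and gaps.* A communicating model has a constant optimal gain `g` and a bias `h` such that all
gaps `g + h(s) - r(s, a) - (P h)(s, a)` are nonnegative and some nonempty set of states can be kept
forever by playing pairs of gap zero (`MDP.exists_bellman`). By Dynkin's formula the regret of
a learner is, up to a bounded term, the expected sum of the gaps of the pairs it plays. A consistent
learner hence visits the pairs of positive gap only `o(T ^ η)` times in expectation, for every
`η > 0` (`MDP.isLittleO_integral_count`).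

*Separation.* Let `Z` be the set of pairs of gap zero in both models. If in `M'` some nonempty set
of states could be kept forever by playing pairs of `Z`, the same would hold in `M`, because
`M ≪ M'`, and a policy reaching this set from everywhere would be optimal in both models, which is
excluded (`MDP.not_isTrap_inter`). Otherwise there is a potential that decreases along `Z` in `M'`,
and an exponential supermartingale shows that staying in `Z` for almost all of the first `T` steps
is exponentially unlikely in `M'` (`MDP.exists_exp_bound`). The event is that pairs of positive gap
in `M` are visited at most `c T` times. It has probability tending to one in `M`. In `M'` it forces
either a long stay in `Z`, or linearly many visits to pairs of positive gap in `M'`, so that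
Markov's inequality bounds its probability by `o(T ^ (ε - 1))` (`MDP.exists_separating_events`).
-/

namespace LearnMDP

/-! ### The Donsker–Varadhan inequality -/

/-- The logarithm on `[1, ∞)`, as a function with values in `[0, ∞]`. It is `0` on `[0, 1]` and
at `∞`. -/
noncomputable def logE (y : ℝ≥0∞) : ℝ≥0∞ := ENNReal.ofReal (Real.log y.toReal)

@[fun_prop]
lemma measurable_logE : Measurable logE := by
  unfold logE
  fun_prop

/-- `DVBound μ ν K` says that `K` is an upper bound of the relative entropy of `μ` with respect to
`ν`, in the variational form of Donsker and Varadhan: `∫ log F ∂μ ≤ K + log ∫ F ∂ν` for every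
bounded measurable `F ≥ 1`. Restricting to `F ≥ 1` keeps all the terms in `[0, ∞]`. -/
def DVBound {α : Type*} [MeasurableSpace α] (μ ν : Measure α) (K : ℝ≥0∞) : Prop :=
  ∀ F : α → ℝ≥0∞, Measurable F → (∀ x, 1 ≤ F x) → (∃ C : ℝ≥0∞, C ≠ ∞ ∧ ∀ x, F x ≤ C) →
    ∫⁻ x, logE (F x) ∂μ ≤ K + logE (∫⁻ x, F x ∂ν)

namespace DVBound

variable {α β : Type*} [MeasurableSpace α] [MeasurableSpace β]

lemma mono {μ ν : Measure α} {K L : ℝ≥0∞} (h : DVBound μ ν K) (hKL : K ≤ L) : DVBound μ ν L :=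
  fun F hF h1 hC => (h F hF h1 hC).trans (by gcongr)

/-- The Donsker–Varadhan inequality: the relative entropy of `μ` with respect to the tilted measure
of density proportional to `F` is nonnegative. -/
lemma klDiv (μ ν : Measure α) [IsProbabilityMeasure μ] [IsProbabilityMeasure ν] :
    DVBound μ ν (InformationTheory.klDiv μ ν) := by
  rintro F hF h1 ⟨C, hC, hFC⟩
  by_cases htop : InformationTheory.klDiv μ ν = ∞
  · simp [htop]
  obtain ⟨hac, hint⟩ := InformationTheory.klDiv_ne_top_iff.1 htop
  have hFtop : ∀ x, F x ≠ ∞ := fun x => ((hFC x).trans_lt (lt_top_iff_ne_top.2 hC)).ne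
  have hF1 : ∀ x, 1 ≤ (F x).toReal := fun x => by
    simpa using ENNReal.toReal_mono (hFtop x) (h1 x)
  have hFC' : ∀ x, (F x).toReal ≤ C.toReal := fun x => ENNReal.toReal_mono hC (hFC x)
  set f : α → ℝ := fun x => Real.log (F x).toReal with hf
  have hfm : Measurable f := by fun_prop
  have hf0 : ∀ x, 0 ≤ f x := fun x => Real.log_nonneg (hF1 x)
  have hexp : ∀ x, Real.exp (f x) = (F x).toReal := fun x =>
    Real.exp_log (by linarith [hF1 x])
  have hfint : Integrable f μ := by
    refine Integrable.of_bound hfm.aestronglyMeasurable (Real.log C.toReal)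
      (ae_of_all _ fun x => ?_)
    rw [Real.norm_of_nonneg (hf0 x)]
    exact Real.log_le_log (by linarith [hF1 x]) (hFC' x)
  have hexpint : Integrable (fun x => Real.exp (f x)) ν := by
    simp only [hexp]
    refine Integrable.of_bound hF.ennreal_toReal.aestronglyMeasurable C.toReal
      (ae_of_all _ fun x => ?_)
    rw [Real.norm_of_nonneg ENNReal.toReal_nonneg]
    exact hFC' x
  have htilt := integral_llr_tilted_right hac hfint hexpint hint
  have hprob : IsProbabilityMeasure (ν.tilted f) := isProbabilityMeasure_tilted hexpint
  have hac' : μ ≪ ν.tilted f := hac.trans (absolutelyContinuous_tilted hexpint)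
  have hnn := InformationTheory.integral_llr_add_sub_measure_univ_nonneg hac'
    (integrable_llr_tilted_right hac hfint hint hexpint)
  simp only [probReal_univ, add_sub_cancel_right] at hnn
  have hkl : InformationTheory.klDiv μ ν = ENNReal.ofReal (∫ x, llr μ ν x ∂μ) := by
    rw [InformationTheory.klDiv_of_ac_of_integrable hac hint]
    simp
  have hlog : logE (∫⁻ x, F x ∂ν) = ENNReal.ofReal (Real.log (∫ x, Real.exp (f x) ∂ν)) := by
    unfold logE
    simp only [hexp]
    rw [integral_toReal hF.aemeasurable (ae_of_all _ fun x => lt_top_iff_ne_top.2 (hFtop x))]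
  calc ∫⁻ x, logE (F x) ∂μ = ENNReal.ofReal (∫ x, f x ∂μ) :=
        (ofReal_integral_eq_lintegral_ofReal hfint (ae_of_all _ hf0)).symm
    _ ≤ ENNReal.ofReal (∫ x, llr μ ν x ∂μ + Real.log (∫ x, Real.exp (f x) ∂ν)) :=
        ENNReal.ofReal_le_ofReal (by linarith)
    _ ≤ _ := by
        rw [hkl, hlog]
        exact ENNReal.ofReal_add_le

/-- Jensen's inequality for the logarithm. -/
lemma refl (μ : Measure α) [IsProbabilityMeasure μ] : DVBound μ μ 0 := by
  simpa using DVBound.klDiv μ μ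

lemma map {μ ν : Measure α} {K : ℝ≥0∞} (h : DVBound μ ν K) {f : α → β} (hf : Measurable f) :
    DVBound (μ.map f) (ν.map f) K := by
  rintro F hF h1 ⟨C, hC, hFC⟩
  rw [lintegral_map (by fun_prop) hf, lintegral_map hF hf]
  exact h _ (hF.comp hf) (fun x => h1 _) ⟨C, hC, fun x => hFC _⟩

/-- The chain rule, as an inequality. -/
lemma compProd {μ ν : Measure α} [SFinite μ] [SFinite ν] {K : ℝ≥0∞}
    (h : DVBound μ ν K) {κ η : Kernel α β} [IsMarkovKernel κ] [IsMarkovKernel η] {k : α → ℝ≥0∞}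
    (hk : ∀ x, DVBound (κ x) (η x) (k x)) :
    DVBound (μ ⊗ₘ κ) (ν ⊗ₘ η) (K + ∫⁻ x, k x ∂μ) := by
  rintro F hF h1 ⟨C, hC, hFC⟩
  rw [Measure.lintegral_compProd (by fun_prop), Measure.lintegral_compProd hF]
  have hG : Measurable fun x => ∫⁻ y, F (x, y) ∂(η x) := hF.lintegral_kernel_prod_right'
  calc ∫⁻ x, ∫⁻ y, logE (F (x, y)) ∂(κ x) ∂μ
      ≤ ∫⁻ x, (k x + logE (∫⁻ y, F (x, y) ∂(η x))) ∂μ :=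
        lintegral_mono fun x => hk x _ (by fun_prop) (fun y => h1 _) ⟨C, hC, fun y => hFC _⟩
    _ = ∫⁻ x, k x ∂μ + ∫⁻ x, logE (∫⁻ y, F (x, y) ∂(η x)) ∂μ :=
        lintegral_add_right _ (measurable_logE.comp hG)
    _ ≤ ∫⁻ x, k x ∂μ + (K + logE (∫⁻ x, ∫⁻ y, F (x, y) ∂(η x) ∂ν)) := by
        gcongr
        refine h _ hG (fun x => ?_) ⟨C, hC, fun x => ?_⟩
        · calc (1 : ℝ≥0∞) = ∫⁻ _, 1 ∂(η x) := by simp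
            _ ≤ _ := lintegral_mono fun y => h1 _
        · calc ∫⁻ y, F (x, y) ∂(η x) ≤ ∫⁻ _, C ∂(η x) := lintegral_mono fun y => hFC _
            _ = C := by simp
    _ = _ := by rw [← add_assoc, add_comm (∫⁻ x, k x ∂μ)]

/-- The form in which the information lower bound is used: an event which is likely under `μ` and
unlikely under `ν` makes the relative entropy large. -/
lemma mul_measureReal_le {μ ν : Measure α} [IsProbabilityMeasure μ] [IsProbabilityMeasure ν]
    {K : ℝ≥0∞} (h : DVBound μ ν K) {B : Set α} (hB : MeasurableSet B) {l : ℝ} (hl : 0 ≤ l) :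
    ENNReal.ofReal (l * μ.real B) ≤ K + ENNReal.ofReal (Real.log (1 + Real.exp l * ν.real B)) := by
  classical
  set F : α → ℝ≥0∞ := fun x => 1 + B.indicator (fun _ => ENNReal.ofReal (Real.exp l - 1)) x with hF
  have hel : 0 ≤ Real.exp l - 1 := by linarith [Real.add_one_le_exp l]
  have hFm : Measurable F := (measurable_const.indicator hB).const_add _
  have hle : ∀ x, F x ≤ 1 + ENNReal.ofReal (Real.exp l - 1) := fun x => by
    simp only [hF]
    gcongr
    exact Set.indicator_le_self' (fun _ _ => by simp) x
  have key := h F hFm (fun x => le_self_add) ⟨_, by simp, hle⟩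
  have h1 : ∫⁻ x, logE (F x) ∂μ = ENNReal.ofReal (l * μ.real B) := by
    have : ∀ x, logE (F x) = B.indicator (fun _ => ENNReal.ofReal l) x := by
      intro x
      by_cases hx : x ∈ B
      · have : F x = ENNReal.ofReal (Real.exp l) := by
          simp only [hF, Set.indicator_of_mem hx]
          rw [← ENNReal.ofReal_one, ← ENNReal.ofReal_add zero_le_one hel]
          congr 1
          ring
        rw [this, logE, ENNReal.toReal_ofReal (Real.exp_pos _).le, Real.log_exp,
          Set.indicator_of_mem hx]
      · simp [hF, logE, Set.indicator_of_notMem hx]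
    simp only [this]
    rw [lintegral_indicator_const hB, ENNReal.ofReal_mul hl, ofReal_measureReal]
  have h2 : ∫⁻ x, F x ∂ν = ENNReal.ofReal (1 + (Real.exp l - 1) * ν.real B) := by
    rw [lintegral_add_left measurable_const, lintegral_indicator_const hB,
      ENNReal.ofReal_add zero_le_one (by positivity), ENNReal.ofReal_mul hel, ofReal_measureReal]
    simp
  rw [h1, h2, logE, ENNReal.toReal_ofReal (by positivity)] at key
  refine key.trans ?_
  gcongr
  linarith

end DVBound

namespace MDP

section

variable {S : Type*} {A : S → Type*}

/-! ### Means over the next state -/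

/-- The mean reward of the pair `x`. -/
noncomputable def meanReward (M : MDP A) (x : Pair A) : ℝ := ∫ r, r ∂(M.reward x)

/-- The trajectory up to time `n`. -/
abbrev past (n : ℕ) : (ℕ → Pair A × ℝ) → Finset.Iic n → Pair A × ℝ :=
  Preorder.frestrictLe (π := fun _ => Pair A × ℝ) n

lemma measurable_past (n : ℕ) : Measurable (past (A := A) n) :=
  Preorder.measurable_frestrictLe n

lemma measurable_pair (u : Pair A → ℝ) (n : ℕ) :
    Measurable fun ω : ℕ → Pair A × ℝ => u (ω n).1 :=
  (Measurable.of_discrete (f := u)).comp (by fun_prop)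

lemma sum_pmf {α : Type*} [Fintype α] (q : PMF α) : ∑ a, q a = 1 := by
  rw [← tsum_fintype (L := .unconditional _)]
  exact q.tsum_coe

variable [Fintype S]

/-- The mean of a nonnegative function of the next state, after the pair `x`. -/
noncomputable def nextLE (M : MDP A) (f : S → ℝ≥0∞) (x : Pair A) : ℝ≥0∞ := ∑ s, M.trans x s * f s

/-- The mean of a function of the next state, after the pair `x`. -/
noncomputable def next (M : MDP A) (h : S → ℝ) (x : Pair A) : ℝ := ∑ s, (M.trans x s).toReal * h s

lemma sum_trans_toReal (M : MDP A) (x : Pair A) : ∑ s, (M.trans x s).toReal = 1 := by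
  rw [← ENNReal.toReal_sum fun s _ => (M.trans x).apply_ne_top s, sum_pmf]
  simp

lemma next_add (M : MDP A) (h k : S → ℝ) (x : Pair A) :
    M.next (fun s => h s + k s) x = M.next h x + M.next k x := by
  simp [next, mul_add, Finset.sum_add_distrib]

lemma next_const_mul (M : MDP A) (c : ℝ) (h : S → ℝ) (x : Pair A) :
    M.next (fun s => c * h s) x = c * M.next h x := by
  simp only [next, Finset.mul_sum]
  exact Finset.sum_congr rfl fun s _ => by ring

lemma next_const (M : MDP A) (c : ℝ) (x : Pair A) : M.next (fun _ => c) x = c := by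
  rw [next, ← Finset.sum_mul, sum_trans_toReal, one_mul]

lemma next_mono (M : MDP A) {h k : S → ℝ} {x : Pair A} (hk : ∀ s, h s ≤ k s) :
    M.next h x ≤ M.next k x :=
  Finset.sum_le_sum fun s _ => mul_le_mul_of_nonneg_left (hk s) ENNReal.toReal_nonneg

lemma nextLE_ofReal (M : MDP A) {h : S → ℝ} (hh : ∀ s, 0 ≤ h s) (x : Pair A) :
    M.nextLE (fun s => ENNReal.ofReal (h s)) x = ENNReal.ofReal (M.next h x) := by
  rw [nextLE, next, ENNReal.ofReal_sum_of_nonneg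
    fun s _ => mul_nonneg ENNReal.toReal_nonneg (hh s)]
  refine Finset.sum_congr rfl fun s _ => ?_
  rw [ENNReal.ofReal_mul ENNReal.toReal_nonneg, ENNReal.ofReal_toReal ((M.trans x).apply_ne_top s)]

variable [∀ s, Fintype (A s)]

/-! ### The Markov property of the interaction -/

lemma sum_pair {β : Type*} [AddCommMonoid β] (f : Pair A → β) :
    ∑ x, f x = ∑ s, ∑ a, f ⟨s, a⟩ := by
  rw [← Fintype.sum_sigma' (f := fun s a => f ⟨s, a⟩)]
  exact (Fintype.sum_equiv (⟨fun x => ⟨x.1, x.2⟩, fun x => ⟨x.1, x.2⟩, fun _ => rfl, fun _ => rfl⟩ :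
    (Σ s, A s) ≃ Pair A) _ _ fun _ => rfl).symm

lemma lintegral_pairLaw (q : PMF S) (p : ∀ s, PMF (A s)) (f : Pair A → ℝ≥0∞) :
    ∫⁻ x, f x ∂(pairLaw q p).toMeasure = ∑ s, q s * ∑ a, p s a * f ⟨s, a⟩ := by
  rw [lintegral_fintype, sum_pair]
  refine Finset.sum_congr rfl fun s _ => ?_
  rw [Finset.mul_sum]
  refine Finset.sum_congr rfl fun a _ => ?_
  rw [PMF.toMeasure_apply_singleton _ _ (measurableSet_singleton _), pairLaw_apply]
  ring

lemma lintegral_pairLaw_state (q : PMF S) (p : ∀ s, PMF (A s)) (f : S → ℝ≥0∞) :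
    ∫⁻ x, f x.state ∂(pairLaw q p).toMeasure = ∑ s, q s * f s := by
  rw [lintegral_pairLaw]
  refine Finset.sum_congr rfl fun s _ => ?_
  simp only
  rw [← Finset.sum_mul, sum_pmf, one_mul]

lemma stepKernel_apply (M : MDP A) (Λ : Learner A) (n : ℕ) (h : Finset.Iic n → Pair A × ℝ) :
    M.stepKernel Λ n h = M.pairKernel Λ n h ⊗ₘ M.rewardKernel := by
  rw [stepKernel, Kernel.compProd_apply_eq_compProd_sectR]
  congr 1

lemma map_past_compProd (M : MDP A) (Λ : Learner A) (s₀ : S) (n : ℕ) :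
    (M.law Λ s₀).map (past n) ⊗ₘ M.stepKernel Λ n =
      (M.law Λ s₀).map (fun ω => (past n ω, ω (n + 1))) :=
  Kernel.map_frestrictLe_trajMeasure_compProd_eq_map_trajMeasure
    (X := fun _ => Pair A × ℝ) (κ := M.stepKernel Λ)

/-- Given the past, the next step is drawn from the step kernel. -/
lemma lintegral_past_succ (M : MDP A) (Λ : Learner A) (s₀ : S) (n : ℕ)
    {F : (Finset.Iic n → Pair A × ℝ) × (Pair A × ℝ) → ℝ≥0∞} (hF : Measurable F) :
    ∫⁻ ω, F (past n ω, ω (n + 1)) ∂(M.law Λ s₀) =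
      ∫⁻ ω, ∫⁻ y, F (past n ω, y) ∂(M.stepKernel Λ n (past n ω)) ∂(M.law Λ s₀) := by
  have h1 : Measurable fun ω : ℕ → Pair A × ℝ => (past n ω, ω (n + 1)) :=
    (measurable_past n).prodMk (measurable_pi_apply _)
  rw [← lintegral_map hF h1, ← map_past_compProd, Measure.lintegral_compProd hF,
    lintegral_map hF.lintegral_kernel_prod_right' (measurable_past n)]

lemma map_past_zero (M : MDP A) (Λ : Learner A) (s₀ : S) :
    (M.law Λ s₀).map (past 0) = (M.initLaw Λ s₀).map fun y _ => y := by
  unfold law Kernel.trajMeasure past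
  rw [Measure.map_comp _ _ (by fun_prop), Kernel.traj_map_frestrictLe, Kernel.partialTraj_self,
    Measure.id_comp]
  congr 1

lemma map_zero (M : MDP A) (Λ : Learner A) (s₀ : S) :
    (M.law Λ s₀).map (fun ω => ω 0) = M.initLaw Λ s₀ := by
  have h : (fun ω : ℕ → Pair A × ℝ => ω 0) =
    (fun h : Finset.Iic 0 → Pair A × ℝ => h ⟨0, Finset.mem_Iic.2 le_rfl⟩) ∘ past 0 := rfl
  rw [h, ← Measure.map_map (measurable_pi_apply _) (measurable_past 0), map_past_zero,
    Measure.map_map (measurable_pi_apply _) (by fun_prop)]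
  exact Measure.map_id

/-- Given the pair of time `n`, the reward is drawn from the reward law of this pair. -/
lemma lintegral_step (M : MDP A) (Λ : Learner A) (s₀ : S) (n : ℕ) {F : Pair A × ℝ → ℝ≥0∞}
    (hF : Measurable F) :
    ∫⁻ ω, F (ω n) ∂(M.law Λ s₀) =
      ∫⁻ ω, ∫⁻ r, F ((ω n).1, r) ∂(M.rewardKernel (ω n).1) ∂(M.law Λ s₀) := by
  have hG : Measurable fun y : Pair A × ℝ => ∫⁻ r, F (y.1, r) ∂(M.rewardKernel y.1) :=
    (hF.lintegral_kernel_prod_right' (κ := M.rewardKernel)).comp measurable_fst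
  have key : ∀ ν : Measure (Pair A), IsProbabilityMeasure ν →
      ∫⁻ y, F y ∂(ν ⊗ₘ M.rewardKernel) =
        ∫⁻ y, ∫⁻ r, F (y.1, r) ∂(M.rewardKernel y.1) ∂(ν ⊗ₘ M.rewardKernel) := fun ν hν => by
    rw [Measure.lintegral_compProd hF, Measure.lintegral_compProd hG]
    simp
  rcases n with _ | n
  · rw [← lintegral_map hF (measurable_pi_apply 0), ← lintegral_map hG (measurable_pi_apply 0),
      map_zero]
    exact key _ inferInstance
  · rw [lintegral_past_succ M Λ s₀ n (F := fun p => F p.2) (hF.comp measurable_snd),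
      lintegral_past_succ M Λ s₀ n
        (F := fun p => ∫⁻ r, F (p.2.1, r) ∂(M.rewardKernel p.2.1)) (hG.comp measurable_snd)]
    refine lintegral_congr fun ω => ?_
    rw [stepKernel_apply]
    exact key _ inferInstance

lemma map_step (M : MDP A) (Λ : Learner A) (s₀ : S) (n : ℕ) :
    (M.law Λ s₀).map (fun ω => ω n) =
      (M.law Λ s₀).map (fun ω => (ω n).1) ⊗ₘ M.rewardKernel := by
  refine Measure.ext_of_lintegral _ fun F hF => ?_
  have h1 : Measurable fun ω : ℕ → Pair A × ℝ => (ω n).1 := by fun_prop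
  rw [Measure.lintegral_compProd hF, lintegral_map hF (by fun_prop),
    lintegral_map hF.lintegral_kernel_prod_right' h1, lintegral_step M Λ s₀ n hF]

/-- Given the past, the next state is drawn from the transition law of the last pair. -/
lemma lintegral_state_succ (M : MDP A) (Λ : Learner A) (s₀ : S) (n : ℕ)
    {φ : (Finset.Iic n → Pair A × ℝ) → ℝ≥0∞} (hφ : Measurable φ) (f : S → ℝ≥0∞) :
    ∫⁻ ω, φ (past n ω) * f (ω (n + 1)).1.state ∂(M.law Λ s₀) =
      ∫⁻ ω, φ (past n ω) * M.nextLE f (ω n).1 ∂(M.law Λ s₀) := by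
  have hf : Measurable fun y : Pair A × ℝ => f y.1.state :=
    (Measurable.of_discrete (f := fun x : Pair A => f x.state)).comp measurable_fst
  rw [lintegral_past_succ M Λ s₀ n (F := fun p => φ p.1 * f p.2.1.state)
    ((hφ.comp measurable_fst).mul (hf.comp measurable_snd))]
  refine lintegral_congr fun ω => ?_
  simp only
  rw [lintegral_const_mul _ hf, stepKernel_apply, Measure.lintegral_compProd hf]
  simp only [lintegral_const, measure_univ, mul_one]
  congr 1
  exact lintegral_pairLaw_state _ _ _

lemma lintegral_state_zero (M : MDP A) (Λ : Learner A) (s₀ : S) (f : S → ℝ≥0∞) :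
    ∫⁻ ω, f (ω 0).1.state ∂(M.law Λ s₀) = f s₀ := by
  classical
  have hf : Measurable fun y : Pair A × ℝ => f y.1.state :=
    (Measurable.of_discrete (f := fun x : Pair A => f x.state)).comp measurable_fst
  rw [← lintegral_map hf (measurable_pi_apply 0), map_zero, initLaw, Measure.lintegral_compProd hf]
  simp only [lintegral_const, measure_univ, mul_one]
  rw [lintegral_pairLaw_state, Finset.sum_eq_single s₀]
  · simp
  · intro b _ hb
    simp [hb]
  · simp

/-! ### Expected rewards and Dynkin's formula -/

lemma integrable_pair (M : MDP A) (Λ : Learner A) (s₀ : S) (u : Pair A → ℝ) (n : ℕ) :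
    Integrable (fun ω => u (ω n).1) (M.law Λ s₀) := by
  refine Integrable.of_bound (measurable_pair u n).aestronglyMeasurable (∑ x, ‖u x‖)
    (ae_of_all _ fun ω => ?_)
  exact Finset.single_le_sum (f := fun x => ‖u x‖) (fun x _ => norm_nonneg _) (Finset.mem_univ _)

lemma integral_state_succ (M : MDP A) (Λ : Learner A) (s₀ : S) (n : ℕ) (h : S → ℝ) :
    ∫ ω, h (ω (n + 1)).1.state ∂(M.law Λ s₀) = ∫ ω, M.next h (ω n).1 ∂(M.law Λ s₀) := by
  -- a constant is added to `h` to make it nonnegative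
  set c : ℝ := ∑ s, |h s| with hc
  have hnn : ∀ s, 0 ≤ h s + c := fun s => by
    have : |h s| ≤ c := Finset.single_le_sum (f := fun s => |h s|) (fun s _ => abs_nonneg _)
      (Finset.mem_univ s)
    linarith [neg_abs_le (h s)]
  have hnn' : ∀ x, 0 ≤ M.next (fun s => h s + c) x := fun x =>
    Finset.sum_nonneg fun s _ => mul_nonneg ENNReal.toReal_nonneg (hnn s)
  have key : ∫ ω, (h (ω (n + 1)).1.state + c) ∂(M.law Λ s₀) =
      ∫ ω, M.next (fun s => h s + c) (ω n).1 ∂(M.law Λ s₀) := by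
    rw [integral_eq_lintegral_of_nonneg_ae (ae_of_all _ fun ω => hnn _)
        (measurable_pair (fun x => h x.state + c) (n + 1)).aestronglyMeasurable,
      integral_eq_lintegral_of_nonneg_ae (ae_of_all _ fun ω => hnn' _)
        (measurable_pair _ n).aestronglyMeasurable]
    have := lintegral_state_succ M Λ s₀ n (φ := fun _ => 1) measurable_const
      (fun s => ENNReal.ofReal (h s + c))
    simp only [one_mul, nextLE_ofReal M hnn] at this
    rw [this]
  simp only [next_add, next_const] at key
  rw [integral_add (integrable_pair M Λ s₀ (fun x => h x.state) (n + 1)) (integrable_const _),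
    integral_add (integrable_pair M Λ s₀ _ n) (integrable_const _)] at key
  linarith

/-- The interaction starts at `s₀`. -/
lemma integral_state_zero (M : MDP A) (Λ : Learner A) (s₀ : S) (h : S → ℝ) :
    ∫ ω, h (ω 0).1.state ∂(M.law Λ s₀) = h s₀ := by
  classical
  have h0 : ∀ᵐ ω ∂(M.law Λ s₀), (ω 0).1.state = s₀ := by
    have := lintegral_state_zero M Λ s₀ (fun s => if s = s₀ then 0 else 1)
    rw [if_pos rfl, lintegral_eq_zero_iff] at this
    · filter_upwards [this] with ω hω
      by_contra hne
      simp [hne] at hω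
    · exact (Measurable.of_discrete (f := fun x : Pair A => if x.state = s₀ then (0 : ℝ≥0∞) else 1)
        ).comp (by fun_prop)
  rw [integral_congr_ae (g := fun _ => h s₀) (by filter_upwards [h0] with ω hω; rw [hω])]
  simp

lemma integral_sum_pair (M : MDP A) (Λ : Learner A) (s₀ : S) (u : Pair A → ℝ) (T : ℕ) :
    ∫ ω, ∑ t ∈ Finset.range T, u (ω t).1 ∂(M.law Λ s₀) =
      ∑ t ∈ Finset.range T, ∫ ω, u (ω t).1 ∂(M.law Λ s₀) :=
  integral_finsetSum _ fun t _ => integrable_pair M Λ s₀ u t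

/-- Dynkin's formula. -/
lemma integral_dynkin (M : MDP A) (Λ : Learner A) (s₀ : S) (h : S → ℝ) (T : ℕ) :
    ∫ ω, ∑ t ∈ Finset.range T, (h (ω t).1.state - M.next h (ω t).1) ∂(M.law Λ s₀) =
      h s₀ - ∫ ω, h (ω T).1.state ∂(M.law Λ s₀) := by
  rw [integral_sum_pair M Λ s₀ (fun x => h x.state - M.next h x)]
  have : ∀ t, ∫ ω, (h (ω t).1.state - M.next h (ω t).1) ∂(M.law Λ s₀) =
      ∫ ω, h (ω t).1.state ∂(M.law Λ s₀) - ∫ ω, h (ω (t + 1)).1.state ∂(M.law Λ s₀) := fun t => by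
    rw [integral_sub (integrable_pair M Λ s₀ (fun x => h x.state) t) (integrable_pair M Λ s₀ _ t),
      integral_state_succ]
  simp only [this]
  rw [Finset.sum_range_sub', integral_state_zero]

lemma integrable_reward_map (M : MDP A) (Λ : Learner A) (s₀ : S) (n : ℕ) :
    Integrable (fun y : Pair A × ℝ => y.2)
      ((M.law Λ s₀).map (fun ω => (ω n).1) ⊗ₘ M.rewardKernel) := by
  rw [Measure.integrable_compProd_iff (by fun_prop)]
  refine ⟨ae_of_all _ fun x => M.reward_integrable x, ?_⟩
  have : IsProbabilityMeasure ((M.law Λ s₀).map (fun ω => (ω n).1)) :=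
    Measure.isProbabilityMeasure_map
      (by fun_prop : Measurable fun ω : ℕ → Pair A × ℝ => (ω n).1).aemeasurable
  exact Integrable.of_finite

lemma integrable_reward (M : MDP A) (Λ : Learner A) (s₀ : S) (n : ℕ) :
    Integrable (fun ω => (ω n).2) (M.law Λ s₀) := by
  have := integrable_reward_map M Λ s₀ n
  rw [← map_step] at this
  exact this.comp_measurable (measurable_pi_apply n)

/-- The reward of time `n` can be replaced by the mean reward of the pair of time `n`. -/
lemma integral_reward (M : MDP A) (Λ : Learner A) (s₀ : S) (n : ℕ) :
    ∫ ω, (ω n).2 ∂(M.law Λ s₀) = ∫ ω, M.meanReward (ω n).1 ∂(M.law Λ s₀) := by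
  have h2 : AEStronglyMeasurable (fun y : Pair A × ℝ => y.2) ((M.law Λ s₀).map fun ω => ω n) := by
    fun_prop
  have h1 := integral_map (φ := fun ω : ℕ → Pair A × ℝ => ω n)
    (measurable_pi_apply n).aemeasurable h2
  rw [← h1, map_step, Measure.integral_compProd (integrable_reward_map M Λ s₀ n),
    integral_map (by fun_prop : Measurable fun ω : ℕ → Pair A × ℝ => (ω n).1).aemeasurable
      Measurable.of_discrete.aestronglyMeasurable]
  rfl

lemma expReward_eq (M : MDP A) (Λ : Learner A) (s₀ : S) (T : ℕ) :
    M.expReward Λ s₀ T = ∫ ω, ∑ t ∈ Finset.range T, M.meanReward (ω t).1 ∂(M.law Λ s₀) := by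
  rw [expReward, integral_finsetSum _ fun t _ => integrable_reward M Λ s₀ t, integral_sum_pair]
  exact Finset.sum_congr rfl fun t _ => integral_reward M Λ s₀ t

end

section

variable {S : Type*} {A : S → Type*}

/-! ### The information inequality -/

/-- The relative entropy of the transition laws at a pair. -/
noncomputable def transKL (M M' : MDP A) (x : Pair A) : ℝ≥0∞ :=
  letI : MeasurableSpace S := ⊤
  InformationTheory.klDiv (M.trans x).toMeasure (M'.trans x).toMeasure

/-- The relative entropy of the reward laws at a pair. -/
noncomputable def rewardKL (M M' : MDP A) (x : Pair A) : ℝ≥0∞ :=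
  InformationTheory.klDiv (M.reward x) (M'.reward x)

lemma pairKL_eq (M M' : MDP A) (x : Pair A) : M.pairKL M' x = M.transKL M' x + M.rewardKL M' x :=
  rfl

lemma dvBound_rewardKernel (M M' : MDP A) (x : Pair A) :
    DVBound (M.rewardKernel x) (M'.rewardKernel x) (M.rewardKL M' x) :=
  DVBound.klDiv (M.rewardKernel x) (M'.rewardKernel x)

lemma measurable_pairLE (u : Pair A → ℝ≥0∞) (n : ℕ) :
    Measurable fun ω : ℕ → Pair A × ℝ => u (ω n).1 :=
  (Measurable.of_discrete (f := u)).comp (by fun_prop)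

/-- Appending one step to a finite trajectory. -/
def snoc (n : ℕ) (p : (Finset.Iic n → Pair A × ℝ) × (Pair A × ℝ)) (i : Finset.Iic (n + 1)) :
    Pair A × ℝ :=
  if h : i.1 ≤ n then p.1 ⟨i.1, Finset.mem_Iic.2 h⟩ else p.2

lemma measurable_snoc (n : ℕ) : Measurable (snoc (A := A) n) := by
  refine measurable_pi_lambda _ fun i => ?_
  unfold snoc
  split_ifs
  · fun_prop
  · fun_prop

lemma snoc_past (n : ℕ) (ω : ℕ → Pair A × ℝ) : snoc n (past n ω, ω (n + 1)) = past (n + 1) ω := by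
  funext ⟨i, hi⟩
  have hi' := Finset.mem_Iic.1 hi
  by_cases h : i ≤ n
  · simp [snoc, h, past]
  · obtain rfl : i = n + 1 := by omega
    simp [snoc, past]

variable [Fintype S] [∀ s, Fintype (A s)]

/-- Drawing the action from a law that depends only on the state gives no information. -/
lemma dvBound_pairLaw (M M' : MDP A) (x : Pair A) (p : ∀ s, PMF (A s)) :
    DVBound (pairLaw (M.trans x) p).toMeasure (pairLaw (M'.trans x) p).toMeasure
      (M.transKL M' x) := by
  let _ : MeasurableSpace S := ⊤
  let _ : ∀ s, MeasurableSpace (A s) := fun _ => ⊤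
  have : DiscreteMeasurableSpace S := ⟨fun _ => trivial⟩
  have : ∀ s, DiscreteMeasurableSpace (A s) := fun s => ⟨fun _ => trivial⟩
  have hS : ∀ (q : PMF S) (f : S → ℝ≥0∞), ∫⁻ s, f s ∂q.toMeasure = ∑ s, q s * f s := fun q f => by
    rw [lintegral_fintype]
    refine Finset.sum_congr rfl fun s _ => ?_
    rw [PMF.toMeasure_apply_singleton _ _ (measurableSet_singleton _), mul_comm]
  have hA : ∀ (s : S) (f : A s → ℝ≥0∞), ∫⁻ a, f a ∂(p s).toMeasure = ∑ a, p s a * f a :=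
    fun s f => by
      rw [lintegral_fintype]
      refine Finset.sum_congr rfl fun s _ => ?_
      rw [PMF.toMeasure_apply_singleton _ _ (measurableSet_singleton _), mul_comm]
  rintro F hF h1 ⟨C, hC, hFC⟩
  simp only [lintegral_pairLaw, ← hS, ← hA]
  calc ∫⁻ s, ∫⁻ a, logE (F ⟨s, a⟩) ∂(p s).toMeasure ∂(M.trans x).toMeasure
      ≤ ∫⁻ s, logE (∫⁻ a, F ⟨s, a⟩ ∂(p s).toMeasure) ∂(M.trans x).toMeasure := by
        refine lintegral_mono fun s => ?_
        simpa using DVBound.refl (p s).toMeasure (fun a => F ⟨s, a⟩) Measurable.of_discrete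
          (fun a => h1 _) ⟨C, hC, fun a => hFC _⟩
    _ ≤ M.transKL M' x +
        logE (∫⁻ s, ∫⁻ a, F ⟨s, a⟩ ∂(p s).toMeasure ∂(M'.trans x).toMeasure) := by
        refine DVBound.klDiv (M.trans x).toMeasure (M'.trans x).toMeasure _ Measurable.of_discrete
          (fun s => ?_) ⟨C, hC, fun s => ?_⟩
        · calc (1 : ℝ≥0∞) = ∫⁻ _, 1 ∂(p s).toMeasure := by simp
            _ ≤ _ := lintegral_mono fun a => h1 _
        · calc ∫⁻ a, F ⟨s, a⟩ ∂(p s).toMeasure ≤ ∫⁻ _, C ∂(p s).toMeasure :=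
                lintegral_mono fun a => hFC _
            _ = C := by simp

/-- One step reveals a transition out of the last pair, and a reward of the new pair. -/
lemma dvBound_stepKernel (M M' : MDP A) (Λ : Learner A) (n : ℕ) (h : Finset.Iic n → Pair A × ℝ) :
    DVBound (M.stepKernel Λ n h) (M'.stepKernel Λ n h)
      (M.transKL M' (h ⟨n, Finset.mem_Iic.2 le_rfl⟩).1 +
        ∫⁻ y, M.rewardKL M' y.1 ∂(M.stepKernel Λ n h)) := by
  have h1 : Measurable fun y : Pair A × ℝ => M.rewardKL M' y.1 :=
    (Measurable.of_discrete (f := M.rewardKL M')).comp measurable_fst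
  have h2 : ∫⁻ y, M.rewardKL M' y.1 ∂(M.stepKernel Λ n h) =
      ∫⁻ x, M.rewardKL M' x ∂(M.pairKernel Λ n h) := by
    rw [stepKernel_apply, Measure.lintegral_compProd h1]
    simp
  rw [h2, stepKernel_apply, stepKernel_apply]
  exact (dvBound_pairLaw M M' _ _).compProd (dvBound_rewardKernel M M')

/-- The relative entropy between the laws of the trajectory up to time `n`. The transition out of
the pair of time `n` has not been observed yet. -/
lemma dvBound_map_past (M M' : MDP A) (Λ : Learner A) (s₀ : S) (n : ℕ) :
    DVBound ((M.law Λ s₀).map (past n)) ((M'.law Λ s₀).map (past n))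
      (∫⁻ ω, (∑ t ∈ Finset.range n, M.transKL M' (ω t).1 +
        ∑ t ∈ Finset.range (n + 1), M.rewardKL M' (ω t).1) ∂(M.law Λ s₀)) := by
  induction n with
  | zero =>
    rw [map_past_zero, map_past_zero]
    refine DVBound.map ?_ (by fun_prop)
    have h1 : Measurable fun y : Pair A × ℝ => M.rewardKL M' y.1 :=
      (Measurable.of_discrete (f := M.rewardKL M')).comp measurable_fst
    have h2 := (DVBound.refl (pairLaw (PMF.pure s₀) (Λ.act 0 Fin.elim0)).toMeasure).compProd
      (dvBound_rewardKernel M M')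
    have h3 : ∫⁻ ω, M.rewardKL M' (ω 0).1 ∂(M.law Λ s₀) =
        ∫⁻ x, M.rewardKL M' x ∂(pairLaw (PMF.pure s₀) (Λ.act 0 Fin.elim0)).toMeasure := by
      rw [← lintegral_map h1 (measurable_pi_apply 0), map_zero, initLaw,
        Measure.lintegral_compProd h1]
      simp
    simpa [h3, initLaw] using h2
  | succ n ih =>
    have hglue : ∀ N : MDP A, (N.law Λ s₀).map (past (n + 1)) =
        ((N.law Λ s₀).map (past n) ⊗ₘ N.stepKernel Λ n).map (snoc n) := fun N => by
      rw [map_past_compProd, Measure.map_map (measurable_snoc n)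
        ((measurable_past n).prodMk (measurable_pi_apply _))]
      congr 1
      funext ω
      exact (snoc_past n ω).symm
    rw [hglue, hglue]
    refine DVBound.map ?_ (measurable_snoc n)
    refine (ih.compProd (dvBound_stepKernel M M' Λ n)).mono (le_of_eq ?_)
    have hr : Measurable fun y : Pair A × ℝ => M.rewardKL M' y.1 :=
      (Measurable.of_discrete (f := M.rewardKL M')).comp measurable_fst
    have ht : Measurable fun h : Finset.Iic n → Pair A × ℝ =>
        M.transKL M' (h ⟨n, Finset.mem_Iic.2 le_rfl⟩).1 :=
      (Measurable.of_discrete (f := M.transKL M')).comp measurable_lastPair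
    have hr' : Measurable fun h : Finset.Iic n → Pair A × ℝ =>
        ∫⁻ y, M.rewardKL M' y.1 ∂(M.stepKernel Λ n h) :=
      Measurable.lintegral_kernel hr
    rw [lintegral_add_left ht, lintegral_map ht (measurable_past n),
      lintegral_map hr' (measurable_past n), ← lintegral_past_succ M Λ s₀ n
        (F := fun p => M.rewardKL M' p.2.1) (hr.comp measurable_snd)]
    have hm : ∀ u : Pair A → ℝ≥0∞, ∀ m,
        Measurable fun ω : ℕ → Pair A × ℝ => ∑ t ∈ Finset.range m, u (ω t).1 :=
      fun u m => Finset.measurable_sum _ fun t _ => measurable_pairLE u t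
    rw [lintegral_add_left (hm _ _), lintegral_add_left (hm _ _)]
    simp only [Finset.sum_range_succ _ n, Finset.sum_range_succ _ (n + 1)]
    rw [lintegral_add_left (hm _ _), lintegral_add_right _ (measurable_pairLE _ _),
      lintegral_add_right _ (measurable_pairLE _ _), lintegral_add_right _ (measurable_pairLE _ _)]
    have hlast : ∀ ω : ℕ → Pair A × ℝ, past n ω ⟨n, Finset.mem_Iic.2 le_rfl⟩ = ω n := fun _ => rfl
    simp only [hlast]
    abel

lemma sum_visits_mul (u : Pair A → ℝ≥0∞) (T : ℕ) (ω : ℕ → Pair A × ℝ) :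
    ∑ x, (visits T x ω : ℝ≥0∞) * u x = ∑ t ∈ Finset.range T, u (ω t).1 := by
  classical
  simp only [visits, Finset.card_filter, Nat.cast_sum, Finset.sum_mul]
  rw [Finset.sum_comm]
  refine Finset.sum_congr rfl fun t _ => ?_
  rw [Finset.sum_eq_single (ω t).1]
  · simp
  · intro x _ hx
    simp [hx.symm]
  · simp

/-- The information inequality: an event of the first `n + 1` steps which is likely in `M` and
unlikely in `M'` forces the learner to collect information. -/
lemma ofReal_le_expInfo_add (M M' : MDP A) (Λ : Learner A) (s₀ : S) (n : ℕ)
    {B : Set (Finset.Iic n → Pair A × ℝ)} (hB : MeasurableSet B) {l : ℝ} (hl : 0 ≤ l) :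
    ENNReal.ofReal (l * (M.law Λ s₀).real (past n ⁻¹' B)) ≤ M.expInfo M' Λ s₀ (n + 1) +
      ENNReal.ofReal (Real.log (1 + Real.exp l * (M'.law Λ s₀).real (past n ⁻¹' B))) := by
  have hp : ∀ N : MDP A, IsProbabilityMeasure ((N.law Λ s₀).map (past n)) := fun N =>
    Measure.isProbabilityMeasure_map (measurable_past n).aemeasurable
  have hK : (∫⁻ ω, (∑ t ∈ Finset.range n, M.transKL M' (ω t).1 +
      ∑ t ∈ Finset.range (n + 1), M.rewardKL M' (ω t).1) ∂(M.law Λ s₀)) ≤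
      M.expInfo M' Λ s₀ (n + 1) := by
    refine lintegral_mono fun ω => ?_
    rw [sum_visits_mul]
    simp only [pairKL_eq]
    rw [Finset.sum_add_distrib]
    gcongr
    exact n.le_succ
  have := hp M
  have := hp M'
  have key := ((dvBound_map_past M M' Λ s₀ n).mono hK).mul_measureReal_le hB hl
  rwa [map_measureReal_apply (measurable_past n) hB, map_measureReal_apply (measurable_past n) hB]
    at key

end

section

variable {S : Type*} {A : S → Type*}

/-! ### Traps and potentials -/

/-- A nonempty set of states `C` is a trap for the set of pairs `Z` if at every state of `C`
some action allowed by `Z` keeps the next state in `C`. -/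
def IsTrap (M : MDP A) (Z : Set (Pair A)) (C : Set S) : Prop :=
  C.Nonempty ∧ ∀ s ∈ C, ∃ a, (⟨s, a⟩ : Pair A) ∈ Z ∧ ∀ s', M.trans ⟨s, a⟩ s' ≠ 0 → s' ∈ C

/-- If `Z` has no trap, then every pair of `Z` leads with positive probability to a state of lower
rank. The rank counts the rounds after which a state is removed, when in each round one removes the
states at which every action allowed by `Z` may lead to a state already removed. -/
lemma exists_rank [Finite S] (M : MDP A) {Z : Set (Pair A)} (hZ : ∀ C, ¬ M.IsTrap Z C) :
    ∃ d : S → ℕ, ∀ x ∈ Z, ∃ s', M.trans x s' ≠ 0 ∧ d s' < d x.state := by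
  classical
  let step : Set S → Set S := fun C =>
    {s ∈ C | ∃ a, (⟨s, a⟩ : Pair A) ∈ Z ∧ ∀ s', M.trans ⟨s, a⟩ s' ≠ 0 → s' ∈ C}
  let C : ℕ → Set S := fun n => step^[n] Set.univ
  have hsucc : ∀ n, C (n + 1) = step (C n) := fun n => Function.iterate_succ_apply' _ _ _
  have hcard : ∀ n, C n = ∅ ∨ (C n).ncard + n ≤ Nat.card S := by
    intro n
    induction n with
    | zero => exact Or.inr (by simp [C])
    | succ n ih =>
      rcases (C n).eq_empty_or_nonempty with h0 | hne
      · exact Or.inl (by rw [hsucc, h0]; simp [step])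
      · right
        have hlt : (C (n + 1)).ncard < (C n).ncard := by
          refine Set.ncard_lt_ncard ?_ (Set.toFinite _)
          rw [hsucc]
          refine (Set.ssubset_iff_subset_ne).2 ⟨fun s hs => hs.1, fun heq => ?_⟩
          refine hZ (C n) ⟨hne, fun s hs => ?_⟩
          rw [← heq] at hs
          exact hs.2
        have := ih.resolve_left hne.ne_empty
        omega
  have hex : ∀ s, ∃ n, s ∉ C n := fun s => ⟨Nat.card S + 1, by
    rcases hcard (Nat.card S + 1) with h | h
    · simp [h]
    · omega⟩
  refine ⟨fun s => Nat.find (hex s), fun ⟨s, a⟩ hx => ?_⟩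
  have hs := Nat.find_spec (hex s)
  obtain ⟨j, hj⟩ : ∃ j, Nat.find (hex s) = j + 1 := by
    refine Nat.exists_eq_succ_of_ne_zero fun h => ?_
    rw [h] at hs
    exact hs (Set.mem_univ s)
  have hmem : s ∈ C j := by
    by_contra h
    exact Nat.find_min (hex s) (by omega : j < _) h
  rw [hj, hsucc] at hs
  have : ∃ s', M.trans ⟨s, a⟩ s' ≠ 0 ∧ s' ∉ C j := by
    by_contra! h
    exact hs ⟨hmem, a, hx, h⟩
  obtain ⟨s', hp, hs'⟩ := this
  refine ⟨s', hp, ?_⟩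
  have := Nat.find_min' (hex s') hs'
  simp only
  omega

lemma trans_toReal_pos (M : MDP A) {x : Pair A} {s : S} (h : M.trans x s ≠ 0) :
    0 < (M.trans x s).toReal :=
  ENNReal.toReal_pos h ((M.trans x).apply_ne_top s)

variable [Fintype S] [∀ s, Fintype (A s)]

/-- If `Z` has no trap, there is a bounded potential that strictly decreases on average along the
pairs of `Z`. -/
lemma exists_potential (M : MDP A) {Z : Set (Pair A)} (hZ : ∀ C, ¬ M.IsTrap Z C) :
    ∃ w : S → ℝ, (∀ s, 1 ≤ w s) ∧ (∀ s, w s ≤ 2) ∧ ∀ x ∈ Z, M.next w x < w x.state := by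
  obtain ⟨d, hd⟩ := M.exists_rank hZ
  have hδ : ∀ᶠ δ : ℝ in 𝓝[>] 0, δ < 1 ∧ 0 < δ ∧
      ∀ x s, M.trans x s ≠ 0 → δ < (M.trans x s).toReal := by
    have : ∀ᶠ δ : ℝ in 𝓝[>] 0, ∀ x s, M.trans x s ≠ 0 → δ < (M.trans x s).toReal := by
      refine eventually_all.2 fun x => eventually_all.2 fun s => ?_
      by_cases h : M.trans x s = 0
      · exact Eventually.of_forall fun δ h' => absurd h h'
      · filter_upwards [Ioo_mem_nhdsGT (M.trans_toReal_pos h)] with δ hδ _ using hδ.2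
    filter_upwards [this, Ioo_mem_nhdsGT one_pos] with δ h1 h2 using ⟨h2.2, h2.1, h1⟩
  obtain ⟨δ, hδ1, hδ0, hδ⟩ := hδ.exists
  -- the deficit `δ ^ d` decreases with the rank, faster than any transition probability
  refine ⟨fun s => 2 - δ ^ d s, fun s => ?_, fun s => ?_, fun x hx => ?_⟩
  · linarith [pow_le_one₀ (n := d s) hδ0.le hδ1.le]
  · linarith [pow_pos hδ0 (d s)]
  · obtain ⟨s', hp, hlt⟩ := hd x hx
    have h1 : M.next (fun s => 2 - δ ^ d s) x = 2 - M.next (fun s => δ ^ d s) x := by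
      have := M.next_add (fun _ => 2) (fun s => (-1) * δ ^ d s) x
      rw [next_const, next_const_mul] at this
      rw [show (fun s => 2 - δ ^ d s) = fun s => 2 + (-1) * δ ^ d s by funext s; ring, this]
      ring
    have h2 : (M.trans x s').toReal * δ ^ d s' ≤ M.next (fun s => δ ^ d s) x :=
      Finset.single_le_sum (f := fun s => (M.trans x s).toReal * δ ^ d s)
        (fun s _ => mul_nonneg ENNReal.toReal_nonneg (pow_pos hδ0 _).le) (Finset.mem_univ s')
    have h3 : δ ^ d x.state ≤ δ * δ ^ d s' := by
      rw [← pow_succ']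
      exact pow_le_pow_of_le_one hδ0.le hδ1.le hlt
    have h4 : δ * δ ^ d s' < (M.trans x s').toReal * δ ^ d s' :=
      mul_lt_mul_of_pos_right (hδ x s' hp) (pow_pos hδ0 _)
    simp only
    linarith

/-! ### The average-reward optimality inequality -/

/-- The gap of a pair with respect to a candidate gain `g` and a candidate bias `h`: what is
lost, in the long run, by playing the pair. -/
noncomputable def gap (M : MDP A) (g : ℝ) (h : S → ℝ) (x : Pair A) : ℝ :=
  g + h x.state - M.meanReward x - M.next h x

/-- In a communicating model there are a gain and a bias whose gaps are nonnegative, and whose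
pairs of gap zero have a trap. They are found by minimizing the gain among the candidates with
nonnegative gaps: without a trap, adding a small multiple of a potential to the bias would make all
gaps positive, and the gain could be decreased. -/
lemma exists_bellman [Nonempty S] [∀ s, Nonempty (A s)] (M : MDP A) (hM : M.IsCommunicating) :
    ∃ (g : ℝ) (h : S → ℝ) (C : Set S), (∀ x, 0 ≤ M.gap g h x) ∧
      M.IsTrap {x | M.gap g h x = 0} C := by
  set R : ℝ := ∑ x, |M.meanReward x| with hR
  have hRx : ∀ x, |M.meanReward x| ≤ R := fun x =>
    Finset.single_le_sum (f := fun x => |M.meanReward x|) (fun _ _ => abs_nonneg _)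
      (Finset.mem_univ x)
  -- biases are normalized to have minimum zero
  set K : Set (ℝ × (S → ℝ)) := {p | (∀ x, 0 ≤ M.gap p.1 p.2 x) ∧ (∀ s, 0 ≤ p.2 s) ∧
    (∃ s, p.2 s = 0) ∧ p.1 ≤ R} with hK
  have hclosed : IsClosed K := by
    have hg : ∀ x, Continuous fun p : ℝ × (S → ℝ) => M.gap p.1 p.2 x := fun x => by
      unfold gap next
      fun_prop
    have hs : ∀ s, Continuous fun p : ℝ × (S → ℝ) => p.2 s := fun s => by fun_prop
    simp only [hK, Set.ofPred_and, Set.ofPred_forall, Set.ofPred_exists]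
    refine (isClosed_iInter fun x => isClosed_le continuous_const (hg x)).inter
      ((isClosed_iInter fun s => isClosed_le continuous_const (hs s)).inter
        ((isClosed_iUnion_of_finite fun s => isClosed_eq (hs s) continuous_const).inter
          (isClosed_le continuous_fst continuous_const)))
  -- the pairs at a state of bias zero bound the gain from below
  have hgle : ∀ p ∈ K, -R ≤ p.1 := by
    rintro p ⟨h1, h2, ⟨s, hs⟩, -⟩
    obtain ⟨a⟩ := ‹∀ s, Nonempty (A s)› s
    have h3 := h1 ⟨s, a⟩
    have h4 : 0 ≤ M.next p.2 ⟨s, a⟩ :=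
      Finset.sum_nonneg fun s _ => mul_nonneg ENNReal.toReal_nonneg (h2 s)
    have h5 := neg_le_of_abs_le (hRx ⟨s, a⟩)
    simp only [gap, hs] at h3
    linarith
  -- along a path from a state of bias zero, the gap inequalities bound the bias from above
  have hbound : ∀ s s', ∃ B, ∀ p ∈ K, p.2 s = 0 → p.2 s' ≤ B := by
    intro s s'
    induction hM s s' with
    | refl => exact ⟨0, fun p _ h => h.le⟩
    | @tail u v _ huv ih =>
      obtain ⟨B, hB⟩ := ih
      obtain ⟨a, ha⟩ := huv
      have hpos := M.trans_toReal_pos ha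
      refine ⟨(R + B + R) / (M.trans ⟨u, a⟩ v).toReal, fun p hp h0 => ?_⟩
      have h1 := hp.1 ⟨u, a⟩
      have h2 : (M.trans ⟨u, a⟩ v).toReal * p.2 v ≤ M.next p.2 ⟨u, a⟩ :=
        Finset.single_le_sum (f := fun s => (M.trans ⟨u, a⟩ s).toReal * p.2 s)
          (fun s _ => mul_nonneg ENNReal.toReal_nonneg (hp.2.1 s)) (Finset.mem_univ v)
      have h3 := neg_le_of_abs_le (hRx ⟨u, a⟩)
      have h4 := hB p hp h0
      have h5 := hp.2.2.2
      rw [le_div_iff₀ hpos]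
      simp only [gap] at h1
      linarith
  choose B hB using hbound
  have hcompact : IsCompact K := by
    refine (isCompact_Icc (a := ((-R, fun _ => 0) : ℝ × (S → ℝ)))
      (b := (R, fun s' => ∑ s, |B s s'|))).of_isClosed_subset hclosed fun p hp => ?_
    refine ⟨⟨hgle p hp, hp.2.1⟩, ⟨hp.2.2.2, fun s' => ?_⟩⟩
    obtain ⟨s, hs⟩ := hp.2.2.1
    refine (hB s s' p hp hs).trans ((le_abs_self _).trans ?_)
    exact Finset.single_le_sum (f := fun s => |B s s'|) (fun _ _ => abs_nonneg _)
      (Finset.mem_univ s)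
  have hne : K.Nonempty := by
    refine ⟨(R, fun _ => 0), fun x => ?_, fun s => le_rfl, ⟨Classical.arbitrary S, rfl⟩, le_rfl⟩
    simp only [gap, next_const]
    linarith [le_of_abs_le (hRx x)]
  obtain ⟨⟨g, h⟩, hgh, hmin⟩ := hcompact.exists_isMinOn hne continuous_fst.continuousOn
  by_cases htrap : ∃ C, M.IsTrap {x | M.gap g h x = 0} C
  · obtain ⟨C, hC⟩ := htrap
    exact ⟨g, h, C, hgh.1, hC⟩
  -- without a trap, the gain `g` is not minimal
  exfalso
  push Not at htrap
  obtain ⟨w, -, -, hw⟩ := M.exists_potential htrap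
  obtain ⟨ε, hε⟩ : ∃ ε : ℝ, ∀ x, 0 < M.gap g h x + ε * (w x.state - M.next w x) := by
    refine Eventually.exists (f := 𝓝[>] (0 : ℝ)) (eventually_all.2 fun x => ?_)
    rcases (hgh.1 x).eq_or_lt with h0 | hpos
    · filter_upwards [self_mem_nhdsWithin] with ε hε
      have := hw x h0.symm
      rw [← h0, zero_add]
      exact mul_pos hε (by linarith)
    · have hc : Continuous fun ε : ℝ => M.gap g h x + ε * (w x.state - M.next w x) := by fun_prop
      refine (hc.tendsto 0).mono_left nhdsWithin_le_nhds |>.eventually (lt_mem_nhds ?_)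
      simpa using hpos
  obtain ⟨δ, hδ0, hδ⟩ : ∃ δ : ℝ, 0 < δ ∧
      ∀ x, δ < M.gap g h x + ε * (w x.state - M.next w x) := by
    have h1 : ∀ᶠ δ : ℝ in 𝓝[>] 0, ∀ x, δ < M.gap g h x + ε * (w x.state - M.next w x) :=
      eventually_all.2 fun x => mem_of_superset (Ioo_mem_nhdsGT (hε x)) fun δ hδ => hδ.2
    exact (eventually_mem_nhdsWithin.and h1).exists
  obtain ⟨s₁, hs₁⟩ := Finite.exists_min fun s => h s + ε * w s
  have hmem : ((g - δ, fun s => (h s + ε * w s) + (-(h s₁ + ε * w s₁))) : ℝ × (S → ℝ)) ∈ K := by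
    refine ⟨fun x => ?_, fun s => ?_, ⟨s₁, by simp⟩, ?_⟩
    · have := hδ x
      simp only [gap, next_add, next_const, next_const_mul] at this ⊢
      linarith
    · have := hs₁ s
      simp only at this ⊢
      linarith
    · have := hgh.2.2.2
      simp only at this ⊢
      linarith
  have := hmin hmem
  simp only [Set.mem_ofPred_eq] at this
  linarith

end

section

variable {S : Type*} {A : S → Type*}

/-! ### Gains of policies -/

/-- In a communicating model `M`, a policy can be prescribed on a nonempty set of states `C` and
completed so as to reach `C` from everywhere: outside `C`, its pairs have no trap in any model
that dominates `M`. -/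
lemma exists_policy_reaching [Finite S] [∀ s, Nonempty (A s)] (M : MDP A)
    (hM : M.IsCommunicating) {C : Set S} (hC : C.Nonempty) {P : Pair A → Prop}
    (hP : ∀ s ∈ C, ∃ a, P ⟨s, a⟩) :
    ∃ π : ∀ s, A s, (∀ s ∈ C, P ⟨s, π s⟩) ∧ ∀ N : MDP A,
      (∀ x s, M.trans x s ≠ 0 → N.trans x s ≠ 0) →
      ∀ D, ¬ N.IsTrap {x | ∃ s, s ∉ C ∧ x = ⟨s, π s⟩} D := by
  classical
  obtain ⟨c, hc⟩ := hC
  -- the states from which `C` can be reached in `n` steps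
  let reach : ℕ → Set S := fun n =>
    (fun D : Set S => {s | ∃ a s', M.trans ⟨s, a⟩ s' ≠ 0 ∧ s' ∈ D})^[n] C
  have hsucc : ∀ n, reach (n + 1) = {s | ∃ a s', M.trans ⟨s, a⟩ s' ≠ 0 ∧ s' ∈ reach n} :=
    fun n => Function.iterate_succ_apply' _ _ _
  have hex : ∀ s, ∃ n, s ∈ reach n := fun s => by
    induction hM s c using Relation.ReflTransGen.head_induction_on with
    | refl => exact ⟨0, hc⟩
    | @head u v huv _ ih =>
      obtain ⟨n, hn⟩ := ih
      obtain ⟨a, ha⟩ := huv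
      exact ⟨n + 1, by rw [hsucc]; exact ⟨a, v, ha, hn⟩⟩
  have hstep : ∀ s, s ∉ C → ∃ a s', M.trans ⟨s, a⟩ s' ≠ 0 ∧
      Nat.find (hex s') < Nat.find (hex s) := fun s hs => by
    have hfs := Nat.find_spec (hex s)
    obtain ⟨j, hj⟩ : ∃ j, Nat.find (hex s) = j + 1 := by
      refine Nat.exists_eq_succ_of_ne_zero fun h => ?_
      rw [h] at hfs
      exact hs hfs
    rw [hj, hsucc] at hfs
    obtain ⟨a, s', hp, hs'⟩ := hfs
    exact ⟨a, s', hp, by have := Nat.find_min' (hex s') hs'; omega⟩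
  have hact : ∀ s, ∃ a : A s, (s ∈ C → P ⟨s, a⟩) ∧ (s ∉ C → ∃ s', M.trans ⟨s, a⟩ s' ≠ 0 ∧
      Nat.find (hex s') < Nat.find (hex s)) := fun s => by
    by_cases hs : s ∈ C
    · obtain ⟨a, ha⟩ := hP s hs
      exact ⟨a, fun _ => ha, fun h => absurd hs h⟩
    · obtain ⟨a, ha⟩ := hstep s hs
      exact ⟨a, fun h => absurd h hs, fun _ => ha⟩
  choose π hπ using hact
  refine ⟨π, fun s hs => (hπ s).1 hs, fun N hN D ⟨hD, hDZ⟩ => ?_⟩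
  obtain ⟨s, hs, hmin⟩ := Set.exists_min_image D (fun s => Nat.find (hex s)) (Set.toFinite D) hD
  obtain ⟨a, ⟨s₁, hs₁, heq⟩, ha⟩ := hDZ s hs
  cases heq
  obtain ⟨s', hp, hlt⟩ := (hπ s).2 hs₁
  exact absurd (hmin s' (ha s' (hN _ _ hp))) (not_le.2 hlt)

variable [Fintype S] [∀ s, Fintype (A s)]

/-- A policy plays only the pairs it prescribes. -/
lemma ae_ofPolicy (M : MDP A) (π : ∀ s, A s) (s₀ : S) (n : ℕ) :
    ∀ᵐ ω ∂(M.law (Learner.ofPolicy π) s₀), ∃ s, (ω n).1 = ⟨s, π s⟩ := by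
  classical
  set u : Pair A → ℝ≥0∞ := fun x => if ∃ s, x = ⟨s, π s⟩ then 0 else 1 with hu
  have hu1 : Measurable fun y : Pair A × ℝ => u y.1 :=
    (Measurable.of_discrete (f := u)).comp measurable_fst
  have hlaw : ∀ q : PMF S, ∫⁻ x, u x ∂(pairLaw q fun s => PMF.pure (π s)).toMeasure = 0 :=
    fun q => by
    rw [lintegral_pairLaw]
    refine Finset.sum_eq_zero fun s _ => ?_
    rw [mul_eq_zero]
    right
    refine Finset.sum_eq_zero fun a _ => ?_
    by_cases ha : a = π s
    · subst ha
      simp [hu]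
    · simp [ha]
  have key : ∫⁻ ω, u (ω n).1 ∂(M.law (Learner.ofPolicy π) s₀) = 0 := by
    rcases n with _ | n
    · rw [← lintegral_map hu1 (measurable_pi_apply 0), map_zero, initLaw,
        Measure.lintegral_compProd hu1]
      simp only [lintegral_const, measure_univ, mul_one]
      exact hlaw _
    · rw [lintegral_past_succ M _ s₀ n (F := fun p => u p.2.1) (hu1.comp measurable_snd)]
      simp only [stepKernel_apply, Measure.lintegral_compProd hu1, lintegral_const, measure_univ,
        mul_one]
      refine (lintegral_congr fun ω => ?_).trans lintegral_zero
      exact hlaw _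
  rw [lintegral_eq_zero_iff (measurable_pairLE u n)] at key
  filter_upwards [key] with ω hω
  by_contra h
  simp [hu, h] at hω

/-- The expected sum of the gaps is the regret with respect to the candidate gain, up to the
variation of the bias. -/
lemma integral_sum_gap (M : MDP A) (Λ : Learner A) (s₀ : S) (g : ℝ) (h : S → ℝ) (T : ℕ) :
    ∫ ω, ∑ t ∈ Finset.range T, M.gap g h (ω t).1 ∂(M.law Λ s₀) =
      T * g - M.expReward Λ s₀ T + h s₀ - ∫ ω, h (ω T).1.state ∂(M.law Λ s₀) := by
  have h1 := M.integral_dynkin Λ s₀ h T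
  rw [integral_sum_pair M Λ s₀ (fun x => h x.state - M.next h x)] at h1
  rw [expReward_eq, integral_sum_pair, integral_sum_pair]
  have h2 : ∀ t, ∫ ω, M.gap g h (ω t).1 ∂(M.law Λ s₀) =
      ∫ ω, (h (ω t).1.state - M.next h (ω t).1) ∂(M.law Λ s₀) + g -
        ∫ ω, M.meanReward (ω t).1 ∂(M.law Λ s₀) := fun t => by
    have h3 : Integrable (fun ω : ℕ → Pair A × ℝ => h (ω t).1.state - M.next h (ω t).1)
      (M.law Λ s₀) := integrable_pair M Λ s₀ (fun x => h x.state - M.next h x) t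
    have h4 : ∀ x, M.gap g h x = (h x.state - M.next h x + g) - M.meanReward x := fun x => by
      simp only [gap]
      ring
    simp only [h4]
    rw [integral_sub (integrable_pair M Λ s₀ (fun x => h x.state - M.next h x + g) t)
        (integrable_pair M Λ s₀ _ t),
      integral_add h3 (integrable_const _)]
    simp
  simp only [h2, Finset.sum_sub_distrib, Finset.sum_add_distrib, h1]
  simp only [Finset.sum_const, Finset.card_range, nsmul_eq_mul]
  ring

lemma abs_integral_state_le (M : MDP A) (Λ : Learner A) (s₀ : S) (h : S → ℝ) (T : ℕ) :
    |∫ ω, h (ω T).1.state ∂(M.law Λ s₀)| ≤ ∑ s, |h s| := by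
  have := norm_integral_le_of_norm_le_const (μ := M.law Λ s₀) (C := ∑ s, |h s|)
    (f := fun ω => h (ω T).1.state) (ae_of_all _ fun ω =>
      Finset.single_le_sum (f := fun s => |h s|) (fun _ _ => abs_nonneg _) (Finset.mem_univ _))
  simpa using this

/-- With nonnegative gaps, the candidate gain bounds the expected rewards of every learner. -/
lemma integral_sum_gap_le (M : MDP A) (Λ : Learner A) (s₀ : S) (g : ℝ) (h : S → ℝ) (T : ℕ) :
    ∫ ω, ∑ t ∈ Finset.range T, M.gap g h (ω t).1 ∂(M.law Λ s₀) ≤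
      T * g - M.expReward Λ s₀ T + 2 * ∑ s, |h s| := by
  rw [integral_sum_gap]
  have h1 := neg_le_of_abs_le (M.abs_integral_state_le Λ s₀ h T)
  have h2 : |h s₀| ≤ ∑ s, |h s| :=
    Finset.single_le_sum (f := fun s => |h s|) (fun _ _ => abs_nonneg _) (Finset.mem_univ _)
  linarith [le_abs_self (h s₀)]

lemma integral_sum_gap_nonneg {M : MDP A} {g : ℝ} {h : S → ℝ} (hg : ∀ x, 0 ≤ M.gap g h x)
    (Λ : Learner A) (s₀ : S) (T : ℕ) :
    0 ≤ ∫ ω, ∑ t ∈ Finset.range T, M.gap g h (ω t).1 ∂(M.law Λ s₀) :=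
  integral_nonneg fun _ => Finset.sum_nonneg fun _ _ => hg _

lemma tendsto_add_div (g c : ℝ) : Tendsto (fun T : ℕ => g + c / T) atTop (𝓝 g) := by
  simpa using (tendsto_const_div_atTop_nhds_zero_nat c).const_add g

lemma abs_expReward_le (M : MDP A) (Λ : Learner A) (s₀ : S) (T : ℕ) :
    |M.expReward Λ s₀ T| ≤ T * ∑ x, |M.meanReward x| := by
  rw [expReward_eq]
  have := norm_integral_le_of_norm_le_const (μ := M.law Λ s₀) (C := T * ∑ x, |M.meanReward x|)
    (f := fun ω => ∑ t ∈ Finset.range T, M.meanReward (ω t).1) (ae_of_all _ fun ω => by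
      refine (norm_sum_le _ _).trans ((Finset.sum_le_card_nsmul _ _ (∑ x, |M.meanReward x|)
        fun t _ => ?_).trans (by simp))
      exact Finset.single_le_sum (f := fun x => |M.meanReward x|) (fun _ _ => abs_nonneg _)
        (Finset.mem_univ _))
  simpa using this

/-- With nonnegative gaps, the candidate gain bounds the gain of every policy. -/
lemma gain_le {M : MDP A} {g : ℝ} {h : S → ℝ} (hg : ∀ x, 0 ≤ M.gap g h x) (π : ∀ s, A s) (s : S) :
    M.gain π s ≤ g := by
  have hlim := tendsto_add_div g (2 * ∑ s, |h s|)
  rw [gain, ← hlim.liminf_eq]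
  refine liminf_le_liminf ?_ ?_ hlim.isCoboundedUnder_ge
  · filter_upwards [eventually_gt_atTop 0] with T hT
    have hT' : (0 : ℝ) < T := by exact_mod_cast hT
    have h1 := integral_sum_gap_nonneg hg (Learner.ofPolicy π) s T
    have h2 := M.integral_sum_gap_le (Learner.ofPolicy π) s g h T
    rw [div_le_iff₀ hT', add_mul, div_mul_cancel₀ _ hT'.ne']
    linarith
  · refine isBoundedUnder_of_eventually_ge (a := -∑ x, |M.meanReward x|) ?_
    filter_upwards [eventually_gt_atTop 0] with T hT
    have hT' : (0 : ℝ) < T := by exact_mod_cast hT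
    rw [le_div_iff₀ hT']
    have := neg_le_of_abs_le (M.abs_expReward_le (Learner.ofPolicy π) s T)
    linarith

/-- A policy whose gaps vanish on a set `C` that it never leaves, and reaches from everywhere, has
the candidate gain at every state: only the time before reaching `C` is lost, and it is controlled
by a potential. -/
lemma gain_eq {M : MDP A} {g : ℝ} {h : S → ℝ} (hg : ∀ x, 0 ≤ M.gap g h x) {π : ∀ s, A s}
    {C : Set S} (hgap : ∀ s ∈ C, M.gap g h ⟨s, π s⟩ = 0)
    (hstay : ∀ s ∈ C, ∀ s', M.trans ⟨s, π s⟩ s' ≠ 0 → s' ∈ C)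
    (hreach : ∀ D, ¬ M.IsTrap {x | ∃ s, s ∉ C ∧ x = ⟨s, π s⟩} D) (s₀ : S) :
    M.gain π s₀ = g := by
  classical
  refine le_antisymm (gain_le hg π s₀) ?_
  obtain ⟨w, hw1, -, hw⟩ := M.exists_potential hreach
  -- set to zero on `C`, the potential is a supermartingale everywhere under `π`
  set v : S → ℝ := fun s => if s ∈ C then 0 else w s with hv
  have hv0 : ∀ s, 0 ≤ v s := fun s => by
    simp only [hv]
    split_ifs
    · exact le_rfl
    · linarith [hw1 s]
  have hvw : ∀ s, v s ≤ w s := fun s => by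
    simp only [hv]
    split_ifs
    · linarith [hw1 s]
    · exact le_rfl
  have hvC : ∀ s ∈ C, M.next v ⟨s, π s⟩ = 0 := fun s hs => by
    refine Finset.sum_eq_zero fun s' _ => ?_
    by_cases hp : M.trans ⟨s, π s⟩ s' = 0
    · simp [hp]
    · simp [hv, hstay s hs s' hp]
  obtain ⟨k, hk0, hk⟩ : ∃ k : ℝ, 0 ≤ k ∧
      ∀ s, M.gap g h ⟨s, π s⟩ ≤ k * (v s - M.next v ⟨s, π s⟩) := by
    obtain ⟨δ, hδ0, hδ⟩ : ∃ δ : ℝ, 0 < δ ∧ ∀ s, s ∉ C → δ < w s - M.next w ⟨s, π s⟩ := by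
      have h1 : ∀ᶠ δ : ℝ in 𝓝[>] 0, ∀ s, s ∉ C → δ < w s - M.next w ⟨s, π s⟩ :=
        eventually_all.2 fun s => by
          by_cases hs : s ∈ C
          · exact Eventually.of_forall fun _ h' => absurd hs h'
          · have := hw ⟨s, π s⟩ ⟨s, hs, rfl⟩
            exact mem_of_superset (Ioo_mem_nhdsGT (sub_pos.2 this)) fun δ hδ _ => hδ.2
      exact (eventually_mem_nhdsWithin.and h1).exists
    have hG : ∀ x, M.gap g h x ≤ ∑ y, M.gap g h y := fun x =>
      Finset.single_le_sum (fun y _ => hg y) (Finset.mem_univ x)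
    have hG0 : 0 ≤ ∑ y, M.gap g h y := Finset.sum_nonneg fun y _ => hg y
    refine ⟨(∑ y, M.gap g h y) / δ, by positivity, fun s => ?_⟩
    by_cases hs : s ∈ C
    · rw [hgap s hs, hvC s hs]
      simp [hv, hs]
    · have h1 : δ ≤ v s - M.next v ⟨s, π s⟩ := by
        have h2 := hδ s hs
        have h3 := M.next_mono (x := ⟨s, π s⟩) hvw
        have h4 : v s = w s := by simp [hv, hs]
        linarith
      calc M.gap g h ⟨s, π s⟩ ≤ (∑ y, M.gap g h y) / δ * δ := by
            rw [div_mul_cancel₀ _ hδ0.ne']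
            exact hG _
        _ ≤ _ := by gcongr
  set Λ : Learner A := Learner.ofPolicy π
  have hup : ∀ T, ∫ ω, ∑ t ∈ Finset.range T, M.gap g h (ω t).1 ∂(M.law Λ s₀) ≤ k * v s₀ := by
    intro T
    have hae : ∀ᵐ ω ∂(M.law Λ s₀), ∀ n, ∃ s, (ω n).1 = ⟨s, π s⟩ :=
      ae_all_iff.2 fun n => M.ae_ofPolicy π s₀ n
    have hint : ∀ u : Pair A → ℝ,
        Integrable (fun ω => ∑ t ∈ Finset.range T, u (ω t).1) (M.law Λ s₀) := fun u =>
      integrable_finsetSum _ fun t _ => integrable_pair M Λ s₀ u t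
    calc ∫ ω, ∑ t ∈ Finset.range T, M.gap g h (ω t).1 ∂(M.law Λ s₀)
        ≤ ∫ ω, k * ∑ t ∈ Finset.range T, (v (ω t).1.state - M.next v (ω t).1) ∂(M.law Λ s₀) := by
          refine integral_mono_ae (hint _)
            ((hint fun x => v x.state - M.next v x).const_mul k) ?_
          filter_upwards [hae] with ω hω
          rw [Finset.mul_sum]
          refine Finset.sum_le_sum fun t _ => ?_
          obtain ⟨s, hs⟩ := hω t
          rw [hs]
          exact hk s
      _ = k * (v s₀ - ∫ ω, v (ω T).1.state ∂(M.law Λ s₀)) := by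
          rw [integral_const_mul, integral_dynkin]
      _ ≤ k * v s₀ := by
          have : 0 ≤ ∫ ω, v (ω T).1.state ∂(M.law Λ s₀) := integral_nonneg fun _ => hv0 _
          gcongr
          linarith
  have hlim := tendsto_add_div g (-(k * v s₀ + 2 * ∑ s, |h s|))
  rw [gain, ← hlim.liminf_eq]
  refine liminf_le_liminf ?_ hlim.isBoundedUnder_ge ?_
  · filter_upwards [eventually_gt_atTop 0] with T hT
    have hT' : (0 : ℝ) < T := by exact_mod_cast hT
    have h1 := hup T
    rw [integral_sum_gap] at h1
    have h2 := le_of_abs_le (M.abs_integral_state_le Λ s₀ h T)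
    have h3 : |h s₀| ≤ ∑ s, |h s| :=
      Finset.single_le_sum (f := fun s => |h s|) (fun _ _ => abs_nonneg _) (Finset.mem_univ _)
    have h4 := neg_abs_le (h s₀)
    rw [le_div_iff₀ hT', add_mul, div_mul_cancel₀ _ hT'.ne']
    linarith
  · refine IsBoundedUnder.isCoboundedUnder_ge
      (isBoundedUnder_of_eventually_le (a := ∑ x, |M.meanReward x|) ?_)
    filter_upwards [eventually_gt_atTop 0] with T hT
    have hT' : (0 : ℝ) < T := by exact_mod_cast hT
    rw [div_le_iff₀ hT']
    have := le_of_abs_le (M.abs_expReward_le Λ s₀ T)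
    linarith

/-- With nonnegative gaps, a policy with the candidate gain at every state is optimal. -/
lemma optGain_eq {M : MDP A} {g : ℝ} {h : S → ℝ} (hg : ∀ x, 0 ≤ M.gap g h x) {π : ∀ s, A s} {s : S}
    (hπ : M.gain π s = g) : M.optGain s = g := by
  have : Nonempty (∀ s, A s) := ⟨π⟩
  refine le_antisymm (ciSup_le fun π' => gain_le hg π' s) ?_
  rw [← hπ]
  exact le_ciSup (f := fun π => M.gain π s) ⟨g, by rintro _ ⟨π', rfl⟩; exact gain_le hg π' s⟩ π

/-- The candidate of `exists_bellman` is the optimal gain, at every state. -/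
lemma optGain_eq_of_isTrap [∀ s, Nonempty (A s)] {M : MDP A} (hM : M.IsCommunicating) {g : ℝ}
    {h : S → ℝ} (hg : ∀ x, 0 ≤ M.gap g h x) {C : Set S} (hC : M.IsTrap {x | M.gap g h x = 0} C)
    (s : S) : M.optGain s = g := by
  obtain ⟨π, hπ, hreach⟩ := M.exists_policy_reaching hM hC.1
    (P := fun x => M.gap g h x = 0 ∧ ∀ s', M.trans x s' ≠ 0 → s' ∈ C) hC.2
  exact optGain_eq hg (gain_eq hg (fun s hs => (hπ s hs).1) (fun s hs => (hπ s hs).2)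
    (hreach M fun _ _ h => h) s)

end

section

variable {S : Type*} {A : S → Type*}

/-! ### Visits to sets of pairs -/

open Classical in
/-- The number of visits to the set of pairs `Z` during the first `T` steps. -/
noncomputable def count (Z : Set (Pair A)) (T : ℕ) (ω : ℕ → Pair A × ℝ) : ℝ :=
  ∑ t ∈ Finset.range T, if (ω t).1 ∈ Z then 1 else 0

lemma count_nonneg (Z : Set (Pair A)) (T : ℕ) (ω : ℕ → Pair A × ℝ) : 0 ≤ count Z T ω :=
  Finset.sum_nonneg fun _ _ => by split_ifs <;> norm_num

lemma count_union_le (Z Z' : Set (Pair A)) (T : ℕ) (ω : ℕ → Pair A × ℝ) :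
    count (Z ∪ Z') T ω ≤ count Z T ω + count Z' T ω := by
  rw [count, count, count, ← Finset.sum_add_distrib]
  refine Finset.sum_le_sum fun t _ => ?_
  by_cases h1 : (ω t).1 ∈ Z <;> by_cases h2 : (ω t).1 ∈ Z' <;> simp [h1, h2]

lemma measurable_count (Z : Set (Pair A)) (T : ℕ) : Measurable (count Z T) := by
  classical
  exact Finset.measurable_sum _ fun t _ => measurable_pair (fun x => if x ∈ Z then 1 else 0) t

/-- The number of visits during the first `n + 1` steps is determined by the past at time `n`. -/
lemma exists_preimage_past (Z : Set (Pair A)) (n : ℕ) (c : ℝ) :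
    ∃ B : Set (Finset.Iic n → Pair A × ℝ), MeasurableSet B ∧
      past n ⁻¹' B = {ω | count Z (n + 1) ω ≤ c} := by
  classical
  have hm : Measurable fun h : Finset.Iic n → Pair A × ℝ =>
      ∑ t : Finset.Iic n, if (h t).1 ∈ Z then (1 : ℝ) else 0 :=
    Finset.measurable_sum _ fun t _ =>
      (Measurable.of_discrete (f := fun x : Pair A => if x ∈ Z then (1 : ℝ) else 0)).comp
        (by fun_prop)
  refine ⟨_, measurableSet_le hm (measurable_const (a := c)), ?_⟩
  ext ω
  have : ∑ t : Finset.Iic n, (if (past n ω t).1 ∈ Z then (1 : ℝ) else 0) = count Z (n + 1) ω := by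
    rw [count, Nat.range_succ_eq_Iic]
    exact Finset.sum_coe_sort (Finset.Iic n) fun t => if (ω t).1 ∈ Z then (1 : ℝ) else 0
  simp only [Set.mem_preimage, Set.mem_ofPred_eq, this]

variable [Fintype S] [∀ s, Fintype (A s)]

lemma integrable_count (M : MDP A) (Λ : Learner A) (s₀ : S) (Z : Set (Pair A)) (T : ℕ) :
    Integrable (count Z T) (M.law Λ s₀) := by
  classical
  exact integrable_finsetSum _ fun t _ => integrable_pair M Λ s₀ (fun x => if x ∈ Z then 1 else 0) t

/-- Markov's inequality. -/
lemma measureReal_le_count (M : MDP A) (Λ : Learner A) (s₀ : S) (Z : Set (Pair A)) (T : ℕ) {c : ℝ}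
    (hc : 0 < c) :
    (M.law Λ s₀).real {ω | c ≤ count Z T ω} ≤ (∫ ω, count Z T ω ∂(M.law Λ s₀)) / c := by
  rw [le_div_iff₀ hc, mul_comm]
  exact mul_meas_ge_le_integral_of_nonneg (ae_of_all _ fun ω => count_nonneg Z T ω)
    (integrable_count M Λ s₀ Z T) c

/-- With subpolynomial regret, the pairs of positive gap are visited subpolynomially often. -/
lemma isLittleO_integral_count {M : MDP A} {Λ : Learner A} {s₀ : S} {g : ℝ} {h : S → ℝ}
    (hg : ∀ x, 0 ≤ M.gap g h x) (hopt : M.optGain s₀ = g) {η : ℝ} (hη : 0 < η)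
    (hreg : (fun T : ℕ => M.regret Λ s₀ T) =o[atTop] fun T : ℕ => (T : ℝ) ^ η) :
    (fun T : ℕ => ∫ ω, count {x | M.gap g h x ≠ 0} T ω ∂(M.law Λ s₀)) =o[atTop]
      fun T : ℕ => (T : ℝ) ^ η := by
  classical
  obtain ⟨δ, hδ0, hδ⟩ : ∃ δ : ℝ, 0 < δ ∧ ∀ x, M.gap g h x ≠ 0 → δ < M.gap g h x := by
    have h1 : ∀ᶠ δ : ℝ in 𝓝[>] 0, ∀ x, M.gap g h x ≠ 0 → δ < M.gap g h x :=
      eventually_all.2 fun x => by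
        by_cases hx : M.gap g h x = 0
        · exact Eventually.of_forall fun _ h' => absurd hx h'
        · exact mem_of_superset (Ioo_mem_nhdsGT ((hg x).lt_of_ne' hx)) fun δ hδ _ => hδ.2
    exact (eventually_mem_nhdsWithin.and h1).exists
  have hconst : (fun _ : ℕ => 2 * ∑ s, |h s|) =o[atTop] fun T : ℕ => (T : ℝ) ^ η := by
    refine isLittleO_const_left.2 (Or.inr ?_)
    exact tendsto_norm_atTop_atTop.comp
      ((tendsto_rpow_atTop hη).comp tendsto_natCast_atTop_atTop)
  refine IsBigO.trans_isLittleO (g := fun T : ℕ => M.regret Λ s₀ T + 2 * ∑ s, |h s|) ?_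
    (hreg.add hconst)
  refine IsBigO.of_bound δ⁻¹ (Eventually.of_forall fun T => ?_)
  have h1 : δ * ∫ ω, count {x | M.gap g h x ≠ 0} T ω ∂(M.law Λ s₀) ≤
      M.regret Λ s₀ T + 2 * ∑ s, |h s| := by
    rw [regret, hopt, ← integral_const_mul]
    refine le_trans ?_ (M.integral_sum_gap_le Λ s₀ g h T)
    refine integral_mono ((integrable_count M Λ s₀ _ T).const_mul δ)
      (integrable_finsetSum _ fun t _ => integrable_pair M Λ s₀ _ t) fun ω => ?_
    simp only [count, Finset.mul_sum]
    refine Finset.sum_le_sum fun t _ => ?_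
    by_cases hx : M.gap g h (ω t).1 = 0
    · simp [hx]
    · simpa [hx] using (hδ _ hx).le
  have h0 : 0 ≤ ∫ ω, count {x | M.gap g h x ≠ 0} T ω ∂(M.law Λ s₀) :=
    integral_nonneg fun ω => count_nonneg _ _ _
  rw [Real.norm_of_nonneg h0, Real.norm_of_nonneg (le_trans (by positivity) h1), inv_mul_eq_div,
    le_div_iff₀ hδ0, mul_comm]
  exact h1

/-- A multiplicative supermartingale: if multiplying by `c x` compensates the mean growth of `w`
out of every pair `x`, the products of the factors `c` have bounded means against `w`. -/
lemma lintegral_prod_mul_le (M : MDP A) (Λ : Learner A) (s₀ : S) {c : Pair A → ℝ≥0∞}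
    {w : S → ℝ≥0∞} (hcw : ∀ x, c x * M.nextLE w x ≤ w x.state) (T : ℕ) :
    ∫⁻ ω, (∏ t ∈ Finset.range T, c (ω t).1) * w (ω T).1.state ∂(M.law Λ s₀) ≤ w s₀ := by
  induction T with
  | zero => simp [lintegral_state_zero]
  | succ n ih =>
    have hmeas : Measurable fun h : Finset.Iic n → Pair A × ℝ => ∏ t : Finset.Iic n, c (h t).1 :=
      Finset.measurable_prod _ fun t _ =>
        (Measurable.of_discrete (f := c)).comp (by fun_prop)
    have hprod : ∀ ω : ℕ → Pair A × ℝ,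
        ∏ t ∈ Finset.range (n + 1), c (ω t).1 = ∏ t : Finset.Iic n, c (past n ω t).1 := fun ω => by
      rw [Nat.range_succ_eq_Iic]
      exact (Finset.prod_coe_sort (Finset.Iic n) fun t => c (ω t).1).symm
    simp only [hprod]
    rw [lintegral_state_succ M Λ s₀ n (φ := fun h => ∏ t : Finset.Iic n, c (h t).1) hmeas w]
    refine le_trans (lintegral_mono fun ω => ?_) ih
    simp only
    rw [← hprod, Finset.prod_range_succ, mul_assoc]
    gcongr
    exact hcw _

/-- If `Z` has no trap, then it is exponentially unlikely, for every learner, that all but a small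
fraction of the time is spent in `Z`. -/
lemma exists_exp_bound (M : MDP A) {Z : Set (Pair A)} (hZ : ∀ C, ¬ M.IsTrap Z C) :
    ∃ κ a : ℝ, 0 < κ ∧ 0 < a ∧ ∀ (Λ : Learner A) (s₀ : S) (T : ℕ),
      (M.law Λ s₀).real {ω | count Zᶜ T ω ≤ κ * T} ≤ 2 * Real.exp (-a * T) := by
  classical
  obtain ⟨w, hw1, hw2, hw⟩ := M.exists_potential hZ
  obtain ⟨α, hα0, hα⟩ : ∃ α : ℝ, 0 < α ∧ ∀ x ∈ Z, Real.exp α * M.next w x < w x.state := by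
    have h1 : ∀ᶠ α : ℝ in 𝓝[>] 0, ∀ x, x ∈ Z → Real.exp α * M.next w x < w x.state :=
      eventually_all.2 fun x => by
        by_cases hx : x ∈ Z
        · have hc : Continuous fun α : ℝ => Real.exp α * M.next w x := by fun_prop
          have := (hc.tendsto 0).mono_left (nhdsWithin_le_nhds (s := Set.Ioi 0))
          have h2 : Real.exp 0 * M.next w x < w x.state := by simpa using hw x hx
          filter_upwards [this.eventually (gt_mem_nhds h2)] with α hα _ using hα
        · exact Eventually.of_forall fun _ h' => absurd h' hx
    exact (eventually_mem_nhdsWithin.and h1).exists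
  -- the factor is `exp α` on `Z`, and `1 / 2` off `Z`, where `w` may grow from `1` to `2`
  set b : ℝ := α + Real.log 2 with hb
  have hb0 : 0 < b := by have := Real.log_pos one_lt_two; positivity
  set e : Pair A → ℝ := fun x => α - b * (if x ∈ Zᶜ then 1 else 0) with he
  have hn0 : ∀ x, 0 ≤ M.next w x := fun x =>
    Finset.sum_nonneg fun s _ => mul_nonneg ENNReal.toReal_nonneg (by linarith [hw1 s])
  have hcw : ∀ x, ENNReal.ofReal (Real.exp (e x)) * M.nextLE (fun s => ENNReal.ofReal (w s)) x ≤
      ENNReal.ofReal (w x.state) := fun x => by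
    rw [nextLE_ofReal M (fun s => by linarith [hw1 s]), ← ENNReal.ofReal_mul (Real.exp_pos _).le]
    refine ENNReal.ofReal_le_ofReal ?_
    by_cases hx : x ∈ Z
    · simpa [he, hx] using (hα x hx).le
    · have h1 : e x = -Real.log 2 := by
        simp [he, hx, hb]
      have h2 : M.next w x ≤ 2 := (M.next_mono hw2).trans (M.next_const 2 x).le
      rw [h1, Real.exp_neg, Real.exp_log two_pos]
      linarith [hw1 x.state]
  refine ⟨α / (2 * b), α / 2, by positivity, by positivity, fun Λ s₀ T => ?_⟩
  have h1 := M.lintegral_prod_mul_le Λ s₀ hcw T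
  set E : Set (ℕ → Pair A × ℝ) := {ω | count Zᶜ T ω ≤ α / (2 * b) * T} with hE
  have hEm : MeasurableSet E := measurableSet_le (measurable_count _ _) measurable_const
  have h2 : ENNReal.ofReal (Real.exp (α / 2 * T)) * M.law Λ s₀ E ≤
      ∫⁻ ω, (∏ t ∈ Finset.range T, ENNReal.ofReal (Real.exp (e (ω t).1))) *
        ENNReal.ofReal (w (ω T).1.state) ∂(M.law Λ s₀) := by
    rw [← lintegral_indicator_const hEm]
    refine lintegral_mono fun ω => ?_
    by_cases hω : ω ∈ E
    swap
    · simp [Set.indicator_of_notMem hω]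
    rw [Set.indicator_of_mem hω, ← ENNReal.ofReal_prod_of_nonneg fun _ _ => (Real.exp_pos _).le,
      ← Real.exp_sum]
    refine le_trans ?_ (le_mul_of_one_le_right zero_le (by simpa using hw1 _))
    refine ENNReal.ofReal_le_ofReal (Real.exp_le_exp.2 ?_)
    have h3 : ∑ t ∈ Finset.range T, e (ω t).1 = T * α - b * count Zᶜ T ω := by
      simp only [he, Finset.sum_sub_distrib, ← Finset.mul_sum, count]
      simp
    have h4 : b * count Zᶜ T ω ≤ b * (α / (2 * b) * T) := by
      gcongr
      exact hω
    have h5 : b * (α / (2 * b) * T) = α / 2 * T := by field_simp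
    rw [h3]
    linarith
  have h3 : Real.exp (α / 2 * T) * (M.law Λ s₀).real E ≤ 2 := by
    have h4 := ENNReal.toReal_mono (b := ENNReal.ofReal 2) (by simp)
      (h2.trans (h1.trans (ENNReal.ofReal_le_ofReal (hw2 s₀))))
    rwa [ENNReal.toReal_mul, ENNReal.toReal_ofReal (Real.exp_pos _).le,
      ENNReal.toReal_ofReal two_pos.le] at h4
  rw [neg_mul, Real.exp_neg, ← div_eq_mul_inv, le_div_iff₀ (Real.exp_pos _), mul_comm]
  exact h3

/-! ### The lower bound -/

/-- If the pairs of gap zero in both models had a trap in `M'`, a policy reaching this trap from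
everywhere would be optimal in both models. -/
lemma not_isTrap_inter [∀ s, Nonempty (A s)] {M M' : MDP A} (hM : M.IsCommunicating)
    (hac : ∀ x s, M.trans x s ≠ 0 → M'.trans x s ≠ 0)
    (hopt : M'.optPolicies ∩ M.optPolicies = ∅) {g g' : ℝ} {h h' : S → ℝ}
    (hg : ∀ x, 0 ≤ M.gap g h x) (hg' : ∀ x, 0 ≤ M'.gap g' h' x) (C : Set S) :
    ¬ M'.IsTrap {x | M.gap g h x = 0 ∧ M'.gap g' h' x = 0} C := by
  rintro ⟨hne, hC⟩
  obtain ⟨π, hπ, hreach⟩ := M.exists_policy_reaching hM hne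
    (P := fun x => (M.gap g h x = 0 ∧ M'.gap g' h' x = 0) ∧ ∀ s', M'.trans x s' ≠ 0 → s' ∈ C) hC
  have h1 : ∀ s, M.gain π s = g := gain_eq hg (fun s hs => (hπ s hs).1.1)
    (fun s hs s' hp => (hπ s hs).2 s' (hac _ _ hp)) (hreach M fun _ _ h => h)
  have h2 : ∀ s, M'.gain π s = g' := gain_eq hg' (fun s hs => (hπ s hs).1.2)
    (fun s hs => (hπ s hs).2) (hreach M' hac)
  have hmem : π ∈ M'.optPolicies ∩ M.optPolicies :=
    ⟨fun s => (h2 s).trans (optGain_eq hg' (h2 s)).symm,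
      fun s => (h1 s).trans (optGain_eq hg (h1 s)).symm⟩
  rw [hopt] at hmem
  exact hmem

/-- There are events, of the first `T` steps, of probability tending to one in `M` and
of probability almost as small as `1 / T` in `M'`. -/
lemma exists_separating_events [∀ s, Nonempty (A s)] {𝓜 : Set (MDP A)} {M M' : MDP A}
    (hM : M ∈ 𝓜) (hcomm : M.IsCommunicating) (hM' : M' ∈ alternative 𝓜 M) (s₀ : S)
    {Λ : Learner A} (hΛ : Λ.IsConsistent 𝓜) :
    ∃ (Z : Set (Pair A)) (c : ℝ),
      Tendsto (fun T : ℕ => (M.law Λ s₀).real {ω | count Z T ω ≤ c * T}) atTop (𝓝 1) ∧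
      ∀ ε : ℝ, 0 < ε → Tendsto (fun T : ℕ => (T : ℝ) ^ (1 - ε) *
        (M'.law Λ s₀).real {ω | count Z T ω ≤ c * T}) atTop (𝓝 0) := by
  have : Nonempty S := ⟨s₀⟩
  have hac : ∀ x s, M.trans x s ≠ 0 → M'.trans x s ≠ 0 := fun x s hp => (hM'.2.1 x).1 hp
  have hcomm' : M'.IsCommunicating := fun s s' =>
    Relation.ReflTransGen.mono (fun u v ⟨a, ha⟩ => ⟨a, hac _ _ ha⟩) s s' (hcomm s s')
  obtain ⟨g, h, C, hg, hC⟩ := M.exists_bellman hcomm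
  obtain ⟨g', h', C', hg', hC'⟩ := M'.exists_bellman hcomm'
  have ho := optGain_eq_of_isTrap hcomm hg hC s₀
  have ho' := optGain_eq_of_isTrap hcomm' hg' hC' s₀
  obtain ⟨κ, a, hκ, ha, hexp⟩ := M'.exists_exp_bound (not_isTrap_inter hcomm hac hM'.2.2 hg hg')
  set Z : Set (Pair A) := {x | M.gap g h x ≠ 0} with hZ
  set Z' : Set (Pair A) := {x | M'.gap g' h' x ≠ 0} with hZ'
  have hcompl : {x | M.gap g h x = 0 ∧ M'.gap g' h' x = 0}ᶜ = Z ∪ Z' := by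
    ext x
    simp only [Set.mem_compl_iff, Set.mem_ofPred_eq, Set.mem_union, hZ, hZ']
    tauto
  rw [hcompl] at hexp
  have hlit : ∀ η : ℝ, 0 < η → Tendsto (fun T : ℕ =>
      (∫ ω, count Z T ω ∂(M.law Λ s₀)) / (T : ℝ) ^ η) atTop (𝓝 0) := fun η hη =>
    (isLittleO_integral_count hg ho hη (hΛ M hM s₀ η hη)).tendsto_div_nhds_zero
  have hlit' : ∀ η : ℝ, 0 < η → Tendsto (fun T : ℕ =>
      (∫ ω, count Z' T ω ∂(M'.law Λ s₀)) / (T : ℝ) ^ η) atTop (𝓝 0) := fun η hη =>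
    (isLittleO_integral_count hg' ho' hη (hΛ M' hM'.1 s₀ η hη)).tendsto_div_nhds_zero
  refine ⟨Z, κ / 2, ?_, fun ε hε => ?_⟩
  · have hlow : Tendsto (fun T : ℕ => 1 - (2 / κ) *
        ((∫ ω, count Z T ω ∂(M.law Λ s₀)) / (T : ℝ) ^ (1 : ℝ))) atTop (𝓝 1) := by
      simpa using ((hlit 1 one_pos).const_mul (2 / κ)).const_sub 1
    refine tendsto_of_tendsto_of_tendsto_of_le_of_le' hlow tendsto_const_nhds ?_
      (Eventually.of_forall fun T => measureReal_le_one)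
    filter_upwards [eventually_gt_atTop 0] with T hT
    have hT' : (0 : ℝ) < T := by exact_mod_cast hT
    have h1 := M.measureReal_le_count Λ s₀ Z T (c := κ / 2 * T) (by positivity)
    have h2 : (M.law Λ s₀).real {ω | count Z T ω ≤ κ / 2 * T}ᶜ ≤
        (M.law Λ s₀).real {ω | κ / 2 * T ≤ count Z T ω} :=
      measureReal_mono fun ω (hω : ¬ count Z T ω ≤ κ / 2 * T) => (not_le.1 hω).le
    rw [probReal_compl_eq_one_sub (measurableSet_le (measurable_count _ _) measurable_const)] at h2
    have h3 : (∫ ω, count Z T ω ∂(M.law Λ s₀)) / (κ / 2 * T) =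
        (2 / κ) * ((∫ ω, count Z T ω ∂(M.law Λ s₀)) / (T : ℝ) ^ (1 : ℝ)) := by
      rw [Real.rpow_one]
      field_simp
    linarith
  · have hup : Tendsto (fun T : ℕ => 2 * ((T : ℝ) ^ (1 - ε) * Real.exp (-a * T)) + (2 / κ) *
        ((∫ ω, count Z' T ω ∂(M'.law Λ s₀)) / (T : ℝ) ^ ε)) atTop (𝓝 0) := by
      have h1 : Tendsto (fun T : ℕ => (T : ℝ) ^ (1 - ε) * Real.exp (-a * T)) atTop (𝓝 0) :=
        (tendsto_rpow_mul_exp_neg_mul_atTop_nhds_zero (1 - ε) a ha).comp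
          tendsto_natCast_atTop_atTop
      simpa using (h1.const_mul 2).add ((hlit' ε hε).const_mul (2 / κ))
    refine tendsto_of_tendsto_of_tendsto_of_le_of_le' tendsto_const_nhds hup
      (Eventually.of_forall fun T => by positivity) ?_
    filter_upwards [eventually_gt_atTop 0] with T hT
    have hT' : (0 : ℝ) < T := by exact_mod_cast hT
    have h1 := M'.measureReal_le_count Λ s₀ Z' T (c := κ / 2 * T) (by positivity)
    have h2 : (M'.law Λ s₀).real {ω | count Z T ω ≤ κ / 2 * T} ≤
        (M'.law Λ s₀).real {ω | count (Z ∪ Z') T ω ≤ κ * T} +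
          (M'.law Λ s₀).real {ω | κ / 2 * T ≤ count Z' T ω} := by
      refine le_trans (measureReal_mono fun ω hω => ?_) (measureReal_union_le _ _)
      by_contra hne
      rw [Set.mem_union, not_or] at hne
      have h3 : κ * T < count (Z ∪ Z') T ω := not_le.1 hne.1
      have h4 : count Z' T ω < κ / 2 * T := not_le.1 hne.2
      have h5 := count_union_le Z Z' T ω
      have h6 : count Z T ω ≤ κ / 2 * T := hω
      linarith
    have h3 : (T : ℝ) ^ (1 - ε) * ((∫ ω, count Z' T ω ∂(M'.law Λ s₀)) / (κ / 2 * T)) =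
        (2 / κ) * ((∫ ω, count Z' T ω ∂(M'.law Λ s₀)) / (T : ℝ) ^ ε) := by
      rw [Real.rpow_sub hT', Real.rpow_one]
      field_simp
    rw [← h3]
    calc (T : ℝ) ^ (1 - ε) * (M'.law Λ s₀).real {ω | count Z T ω ≤ κ / 2 * T}
        ≤ (T : ℝ) ^ (1 - ε) * (2 * Real.exp (-a * T) +
            (∫ ω, count Z' T ω ∂(M'.law Λ s₀)) / (κ / 2 * T)) := by
          gcongr
          linarith [hexp Λ s₀ T]
      _ = _ := by ring

/-- The separating events, tested at the scale `l = (1 - ε) log T`. -/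
lemma eventually_log_le_expInfo [∀ s, Nonempty (A s)] {𝓜 : Set (MDP A)} {M M' : MDP A}
    (hM : M ∈ 𝓜) (hcomm : M.IsCommunicating) (hM' : M' ∈ alternative 𝓜 M) (s₀ : S)
    {Λ : Learner A} (hΛ : Λ.IsConsistent 𝓜) {ε : ℝ} (hε : 0 < ε) (hε1 : ε < 1) :
    ∀ᶠ T : ℕ in atTop, ENNReal.ofReal ((1 - 3 * ε) * Real.log T) ≤ M.expInfo M' Λ s₀ T := by
  obtain ⟨Z, c, h1, h0⟩ := exists_separating_events hM hcomm hM' s₀ hΛ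
  have hlog : Tendsto (fun T : ℕ => ε * Real.log T) atTop atTop :=
    (Real.tendsto_log_atTop.comp tendsto_natCast_atTop_atTop).const_mul_atTop hε
  filter_upwards [h1.eventually (lt_mem_nhds (by linarith : 1 - ε < 1)),
    (h0 ε hε).eventually (gt_mem_nhds one_pos), hlog.eventually_ge_atTop (Real.log 2),
    eventually_gt_atTop 0] with T hp hq hT hT0
  obtain ⟨n, rfl⟩ := Nat.exists_eq_succ_of_ne_zero hT0.ne'
  have hT' : (0 : ℝ) < ((n + 1 : ℕ) : ℝ) := by positivity
  have hlog0 : 0 ≤ Real.log ((n + 1 : ℕ) : ℝ) := Real.log_natCast_nonneg _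
  obtain ⟨B, hB, hBeq⟩ := exists_preimage_past Z n (c * ((n + 1 : ℕ) : ℝ))
  have key := M.ofReal_le_expInfo_add M' Λ s₀ n hB
    (l := (1 - ε) * Real.log ((n + 1 : ℕ) : ℝ)) (mul_nonneg (by linarith) hlog0)
  have hexp : Real.exp ((1 - ε) * Real.log ((n + 1 : ℕ) : ℝ)) = ((n + 1 : ℕ) : ℝ) ^ (1 - ε) := by
    rw [Real.rpow_def_of_pos hT', mul_comm]
  rw [hBeq, hexp] at key
  set p := (M.law Λ s₀).real {ω | count Z (n + 1) ω ≤ c * ((n + 1 : ℕ) : ℝ)}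
  set q := (M'.law Λ s₀).real {ω | count Z (n + 1) ω ≤ c * ((n + 1 : ℕ) : ℝ)}
  set L := Real.log ((n + 1 : ℕ) : ℝ)
  simp only [Nat.succ_eq_add_one] at hp hq hT ⊢
  have hq0 : 0 ≤ ((n + 1 : ℕ) : ℝ) ^ (1 - ε) * q := mul_nonneg (by positivity) measureReal_nonneg
  have hlog2 : Real.log (1 + ((n + 1 : ℕ) : ℝ) ^ (1 - ε) * q) ≤ Real.log 2 :=
    Real.log_le_log (by linarith) (by linarith)
  have h2 : ENNReal.ofReal ((1 - ε) * L * p) ≤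
      M.expInfo M' Λ s₀ (n + 1) + ENNReal.ofReal (Real.log 2) :=
    key.trans (by gcongr)
  rw [← tsub_le_iff_right, ← ENNReal.ofReal_sub _ (Real.log_nonneg one_le_two)] at h2
  refine le_trans (ENNReal.ofReal_le_ofReal ?_) h2
  have h3 : (1 - ε) * L * (1 - ε) ≤ (1 - ε) * L * p :=
    mul_le_mul_of_nonneg_left hp.le (mul_nonneg (by linarith) hlog0)
  have h4 : 0 ≤ ε * ε * L := by positivity
  linarith

end

end MDP

end LearnMDP

theorem mainTheorem3 {S : Type*} [Fintype S] {A : S → Type*} [∀ s, Fintype (A s)]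
    [∀ s, Nonempty (A s)] (𝓜 : Set (LearnMDP.MDP A)) (M : LearnMDP.MDP A) (hM : M ∈ 𝓜)
    (hcomm : M.IsCommunicating) (M' : LearnMDP.MDP A)
    (hM' : M' ∈ LearnMDP.MDP.alternative 𝓜 M) (s₀ : S) (Λ : LearnMDP.Learner A)
    (hΛ : Λ.IsConsistent 𝓜) :
    ∃ f : ℕ → ℝ, f =o[atTop] (fun T : ℕ => Real.log T) ∧
      ∀ T : ℕ, ((Real.log T + f T : ℝ) : EReal) ≤ (M.expInfo M' Λ s₀ T : EReal) := by
  classical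
  -- `f T` is the amount by which the information falls short of `log T`, negated
  refine ⟨fun T => if M.expInfo M' Λ s₀ T = ∞ then 0 else
    -max 0 (Real.log T - (M.expInfo M' Λ s₀ T).toReal), ?_, fun T => ?_⟩
  · refine isLittleO_iff.2 fun ε hε => ?_
    set δ := min (ε / 3) (1 / 2) with hδ
    have hδ0 : 0 < δ := by positivity
    have hδ1 : δ < 1 := (min_le_right _ _).trans_lt (by norm_num)
    have hδε : 3 * δ ≤ ε := by linarith [min_le_left (ε / 3) (1 / 2)]
    filter_upwards [LearnMDP.MDP.eventually_log_le_expInfo hM hcomm hM' s₀ hΛ hδ0 hδ1] with T hT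
    have hlog0 : 0 ≤ Real.log (T : ℝ) := Real.log_natCast_nonneg T
    rw [Real.norm_of_nonneg hlog0]
    split_ifs with htop
    · simpa using mul_nonneg hε.le hlog0
    · have h1 := (ENNReal.ofReal_le_iff_le_toReal htop).1 hT
      have h2 : 3 * δ * Real.log T ≤ ε * Real.log T := by gcongr
      rw [norm_neg, Real.norm_of_nonneg (le_max_left _ _)]
      exact max_le (mul_nonneg hε.le hlog0) (by linarith)
  · simp only
    split_ifs with htop
    · simp [htop]
    · rw [← EReal.coe_toReal (x := (M.expInfo M' Λ s₀ T : EReal)) (by simpa using htop)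
        (EReal.coe_ennreal_ne_bot _), EReal.toReal_coe_ennreal, EReal.coe_le_coe_iff]
      linarith [le_max_right 0 (Real.log T - (M.expInfo M' Λ s₀ T).toReal)]
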